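/- Let $1<k\le n$. Write $C(n,j)$ for the set of $j$-element subsets of $\{1,\dots,n\}$; for a $(j+1)$-set $X\in C(n,j+1)$ its ($j$-)packet is $P_X=\{A\subseteq X: |A|=j\}$, ordered lexicographically. **Higher Bruhat order.** An admissible $j$-order is a total order on $C(n,j)$ which induces the lexicographic or the antilexicographic order on every $j$-packet; its inversion set is the set of $X\in C(n,j+1)$ on whose packet it is antilexicographic. $B(n,j)$ is the set of admissible $j$-orders modulo the equivalence relation generated by interchanging two neighbours that lie in no common $j$-packet; inversion sets are well defined on $B(n,j)$. For $r\in B(n,j)$ and $X\in C(n,j+1)\setminus\mathrm{Inv}(r)$ such that $P_X$ is a contiguous block in some representative of $r$, reversing this block gives a class $p_X(r)$; we write $r\xrightarrow{X}p_X(r)$. **Realizable sets.** A set $J\subseteq C(n,k)$ is a realizable $k$-set if for every $X\in C(n,k+1)$ the set $P_X\cap J$ is an initial or a final segment (possibly empty or all) of $P_X$ in the lexicographic order. Let $J_s$ be the set of $X\in C(n,k+1)$ such that $P_X\cap J$ is a final segment of $P_X$ different from $\emptyset$ and $P_X$, and let $J_F$ be the set of $X\in C(n,k+1)$ with $P_X\subseteq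 J$. **Paths.** A path from $\emptyset$ to $J$ in $B(n,k-1)$ is a sequence $r_0\xrightarrow{X_1}r_1\xrightarrow{X_2}\cdots\xrightarrow{X_m}r_m$ in $B(n,k-1)$ with $\mathrm{Inv}(r_0)=\emptyset$ and $\mathrm{Inv}(r_m)=J$. It gives the total order $X_1<\dots<X_m$ on $J$. The inversion set of a path $\gamma$ is $$\mathrm{Inv}(\gamma)=J_s\cup\{X\in J_F:\ \gamma\text{ orders }P_X\text{ antilexicographically}\}.$$ Paths are considered modulo the equivalence relation generated by interchanging two neighbours in the associated order that lie in no common $k$-packet; inversion sets are well defined on classes. If $r$ is a class of paths and $X\in J_F\setminus\mathrm{Inv}(r)$ is such that $P_X$ is a contiguous block in some representative of $r$, reversing this block gives a class $p_X(r)$. The Manin–Schechtman relation is: $r\le_{MS}r'$ if $r'$ is obtained from $r$ by a finite (possibly empty) sequence of such flips. The set of classes of paths from $\emptyset$ to $J$ in $B(n,k-1)$ with $\le_{MS}$ is called the second Bruhat order of $J$. **Theorem.** Let $1<k\le n$ and let $J\subseteq C(n,k)$ be a realizable $k$-set. Then the second Bruhat order of $J$ is a partially ordered set, and it has a unique minimal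 element $r_{\min}$ and a unique maximal element $r_{\max}$. These elements are determined by their inversion sets: $r_{\min}$ is the only class with inversion set $J_s$, and $r_{\max}$ is the only class with inversion set $J_s\cup J_F$. -/

import Mathlib

namespace HigherBruhat

/-- `C(n,k)`: the `k`-element subsets of the ordered set `{1 < ... < n}`, modelled by `Fin n`. -/
def C (n k : ℕ) : Finset (Finset (Fin n)) :=
  (Finset.univ : Finset (Fin n)).powersetCard k

/-- The `k`-packet of a `(k+1)`-set `X`: all `k`-element subsets of `X`. -/
def packet {n : ℕ} (k : ℕ) (X : Finset (Fin n)) : Finset (Finset (Fin n)) :=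
  X.powersetCard k

/-- Strict lexicographic order on subsets of the same size: at the first place where the increasing
enumerations differ, `A` has the smaller entry. Equivalently, the smallest element lying in exactly
one of the two sets lies in `A`. -/
def LexLT {n : ℕ} (A B : Finset (Fin n)) : Prop :=
  ∃ a ∈ A, a ∉ B ∧ ∀ b, b < a → (b ∈ A ↔ b ∈ B)

instance {n : ℕ} (A B : Finset (Fin n)) : Decidable (LexLT A B) := by
  unfold LexLT; infer_instance

/-! ### Total orders on finite families of sets

A total order on a finite family `S` is written as the list of the elements of `S` in increasing
order, without repetition. -/

/-- `ρ` is a total order on `S`. -/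
def IsOrderOn {n : ℕ} (ρ : List (Finset (Fin n))) (S : Finset (Finset (Fin n))) : Prop :=
  ρ.Nodup ∧ ρ.toFinset = S

/-- The order induced by `ρ` on the members of `P` that occur in it is the lexicographic one. -/
def InducesLex {n : ℕ} (ρ : List (Finset (Fin n))) (P : Finset (Finset (Fin n))) : Prop :=
  (ρ.filter (fun A => A ∈ P)).Pairwise (fun A B => LexLT A B)

/-- The order induced by `ρ` on the members of `P` that occur in it is the antilexicographic one. -/
def InducesAntilex {n : ℕ} (ρ : List (Finset (Fin n))) (P : Finset (Finset (Fin n))) : Prop :=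
  (ρ.filter (fun A => A ∈ P)).Pairwise (fun A B => LexLT B A)

instance {n : ℕ} (ρ : List (Finset (Fin n))) (P : Finset (Finset (Fin n))) :
    Decidable (InducesAntilex ρ P) := by
  unfold InducesAntilex; infer_instance

/-- Two `k`-sets lie in a common `k`-packet. -/
def SharePacket {n : ℕ} (k : ℕ) (A B : Finset (Fin n)) : Prop :=
  ∃ X ∈ C n (k + 1), A ∈ packet k X ∧ B ∈ packet k X

/-- `ρ'` arises from `ρ` by interchanging two neighbours that are not in a common `k`-packet. -/
def IsElementarySwap {n : ℕ} (k : ℕ) (ρ ρ' : List (Finset (Fin n))) : Prop :=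
  ∃ (l₁ l₂ : List (Finset (Fin n))) (A B : Finset (Fin n)),
    ρ = l₁ ++ A :: B :: l₂ ∧ ρ' = l₁ ++ B :: A :: l₂ ∧ ¬ SharePacket k A B

/-- The packet of `X` forms a contiguous block (a chain) of `ρ`, and `ρ'` is obtained from `ρ` by
reversing this block and leaving everything else in place. -/
def IsPacketFlip {n : ℕ} (k : ℕ) (X : Finset (Fin n)) (ρ ρ' : List (Finset (Fin n))) : Prop :=
  ∃ l₁ c l₂ : List (Finset (Fin n)),
    c.toFinset = packet k X ∧ ρ = l₁ ++ c ++ l₂ ∧ ρ' = l₁ ++ c.reverse ++ l₂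

/-- An elementary swap does not change the order induced on a packet. -/
theorem IsElementarySwap.induced_eq {n k : ℕ} {ρ ρ' : List (Finset (Fin n))}
    (h : IsElementarySwap k ρ ρ') {X : Finset (Fin n)} (hX : X ∈ C n (k + 1)) :
    ρ.filter (fun A => A ∈ packet k X) = ρ'.filter (fun A => A ∈ packet k X) := by
  obtain ⟨l₁, l₂, A, B, rfl, rfl, hAB⟩ := h
  by_cases hA : A ∈ packet k X
  · by_cases hB : B ∈ packet k X
    · exact absurd ⟨X, hX, hA, hB⟩ hAB
    · simp [hA, hB]
  · by_cases hB : B ∈ packet k X <;> simp [hA, hB]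

/-! ### The higher Bruhat order `B(n,k)` -/

/-- `A(n,k)`: the admissible `k`-orders, that is, total orders on `C(n,k)` which induce the
lexicographic or the antilexicographic order on every `k`-packet. -/
def AdmissibleOrder (n k : ℕ) : Type :=
  {ρ : List (Finset (Fin n)) // IsOrderOn ρ (C n k) ∧
    ∀ X ∈ C n (k + 1), InducesLex ρ (packet k X) ∨ InducesAntilex ρ (packet k X)}

/-- The inversion set of an admissible `k`-order: the `(k+1)`-sets on whose packet it is
antilexicographic. -/
def AdmissibleOrder.Inv {n k : ℕ} (ρ : AdmissibleOrder n k) : Finset (Finset (Fin n)) :=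
  (C n (k + 1)).filter (fun X => InducesAntilex ρ.1 (packet k X))

/-- `B(n,k)`: the quotient of `A(n,k)` by the equivalence relation generated by elementary
equivalences. -/
def B (n k : ℕ) : Type :=
  Quot (fun ρ ρ' : AdmissibleOrder n k => IsElementarySwap k ρ.1 ρ'.1)

/-- The class of an admissible order in `B(n,k)`. -/
def B.mk {n k : ℕ} (ρ : AdmissibleOrder n k) : B n k := Quot.mk _ ρ

/-- The inversion set of a class, computed from any representative. -/
def B.Inv {n k : ℕ} : B n k → Finset (Finset (Fin n)) :=
  Quot.lift AdmissibleOrder.Inv (fun ρ ρ' h => by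
    apply Finset.filter_congr
    intro X hX
    unfold InducesAntilex
    rw [h.induced_eq hX])

/-- `r'` is obtained from `r` by the inversion-increasing packet flip at `X`: `r' = p_X(r)`, where
the packet of `X` is a chain in a representative of `r` and `X` is not in the inversion set. -/
def B.FlipUp {n k : ℕ} (X : Finset (Fin n)) (r r' : B n k) : Prop :=
  X ∈ C n (k + 1) ∧ X ∉ r.Inv ∧
    ∃ ρ ρ' : AdmissibleOrder n k, B.mk ρ = r ∧ B.mk ρ' = r' ∧ IsPacketFlip k X ρ.1 ρ'.1

/-! ### Realizable sets -/

/-- `S` is a prefix (initial segment, possibly empty or full) of `T` in the lexicographic order. -/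
def IsPrefix {n : ℕ} (S T : Finset (Finset (Fin n))) : Prop :=
  S ⊆ T ∧ ∀ A ∈ S, ∀ D ∈ T, LexLT D A → D ∈ S

/-- `S` is a suffix (final segment, possibly empty or full) of `T` in the lexicographic order. -/
def IsSuffix {n : ℕ} (S T : Finset (Finset (Fin n))) : Prop :=
  S ⊆ T ∧ ∀ A ∈ S, ∀ D ∈ T, LexLT A D → D ∈ S

instance {n : ℕ} (S T : Finset (Finset (Fin n))) : Decidable (IsSuffix S T) := by
  unfold IsSuffix; infer_instance

/-- `J ⊆ C(n,k)` is realizable: it meets every `k`-packet in a prefix or in a suffix. -/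
def Realizable {n : ℕ} (k : ℕ) (J : Finset (Finset (Fin n))) : Prop :=
  J ⊆ C n k ∧ ∀ X ∈ C n (k + 1),
    IsPrefix (packet k X ∩ J) (packet k X) ∨ IsSuffix (packet k X ∩ J) (packet k X)

/-- `J_s`: the `(k+1)`-sets whose packet meets `J` in a proper suffix, that is, one that is neither
empty nor the whole packet. -/
def suffixSet {n : ℕ} (k : ℕ) (J : Finset (Finset (Fin n))) : Finset (Finset (Fin n)) :=
  (C n (k + 1)).filter (fun X => IsSuffix (packet k X ∩ J) (packet k X) ∧
    packet k X ∩ J ≠ ∅ ∧ packet k X ∩ J ≠ packet k X)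

/-- `J_F`: the `(k+1)`-sets whose packet is contained in `J`. -/
def fullSet {n : ℕ} (k : ℕ) (J : Finset (Finset (Fin n))) : Finset (Finset (Fin n)) :=
  (C n (k + 1)).filter (fun X => packet k X ∩ J = packet k X)

/-! ### Paths from `∅` to `J` in `B(n,k)` -/

/-- `steps = [(X₁, r₁), ..., (Xₘ, rₘ)]` is a sequence of successive inversion-increasing packet
flips `r → r₁ → ... → rₘ` in `B(n,k)`, the `i`-th one at `Xᵢ`. -/
def IsWalk {n k : ℕ} : B n k → List (Finset (Fin n) × B n k) → Prop
  | _, [] => True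
  | r, (X, r') :: steps => B.FlipUp X r r' ∧ IsWalk r' steps

/-- The last class visited. -/
def walkEnd {n k : ℕ} : B n k → List (Finset (Fin n) × B n k) → B n k
  | r, [] => r
  | _, (_, r') :: steps => walkEnd r' steps

/-- A path in `B(n,k)` from `∅` to `J`: a sequence of inversion-increasing packet flips from the
class with inversion set `∅` to the class with inversion set `J`. -/
structure Path (n k : ℕ) (J : Finset (Finset (Fin n))) where
  source : B n k
  steps : List (Finset (Fin n) × B n k)
  source_inv : source.Inv = ∅
  isWalk : IsWalk source steps
  target_inv : (walkEnd source steps).Inv = J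

/-- The total order on `J` given by a path: the order in which the packets are flipped. -/
def Path.order {n k : ℕ} {J : Finset (Finset (Fin n))} (γ : Path n k J) :
    List (Finset (Fin n)) :=
  γ.steps.map Prod.fst

/-- The inversion set of a path from `∅` to `J` in `B(n,k)`:
`{X ∈ J_F | γ is antilexicographic on the (k+1)-packet of X} ∪ J_s`. -/
def Path.Inv {n k : ℕ} {J : Finset (Finset (Fin n))} (γ : Path n k J) :
    Finset (Finset (Fin n)) :=
  (fullSet (k + 1) J).filter (fun X => InducesAntilex γ.order (packet (k + 1) X)) ∪
    suffixSet (k + 1) J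

/-- Equivalence classes of paths from `∅` to `J` in `B(n,k)`, for the equivalence relation generated
by interchanging two neighbouring elements that are not in a common `(k+1)`-packet. -/
def PathClass (n k : ℕ) (J : Finset (Finset (Fin n))) : Type :=
  Quot (fun γ γ' : Path n k J => IsElementarySwap (k + 1) γ.order γ'.order)

/-- The class of a path. -/
def PathClass.mk {n k : ℕ} {J : Finset (Finset (Fin n))} (γ : Path n k J) : PathClass n k J :=
  Quot.mk _ γ

/-- The inversion set of a class of paths, computed from any representative. -/
def PathClass.Inv {n k : ℕ} {J : Finset (Finset (Fin n))} :
    PathClass n k J → Finset (Finset (Fin n)) :=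
  Quot.lift Path.Inv (fun γ γ' h => by
    unfold Path.Inv
    congr 1
    apply Finset.filter_congr
    intro X hX
    unfold InducesAntilex
    rw [h.induced_eq (Finset.mem_filter.mp hX).1])

/-- `r' = p_X(r)` for some `X ∈ J_F` whose packet is a chain in a representative of `r` and which is
not in the inversion set of `r`. -/
def PathClass.FlipUp {n k : ℕ} {J : Finset (Finset (Fin n))} (X : Finset (Fin n))
    (r r' : PathClass n k J) : Prop :=
  X ∈ fullSet (k + 1) J ∧ X ∉ r.Inv ∧
    ∃ γ γ' : Path n k J, PathClass.mk γ = r ∧ PathClass.mk γ' = r' ∧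
      IsPacketFlip (k + 1) X γ.order γ'.order

/-- The Manin–Schechtman relation: `r ≤ r'` when `r'` is reached from `r` by a finite (possibly
empty) sequence of inversion-increasing packet flips. Antisymmetry is not part of this instance. -/
instance (n k : ℕ) (J : Finset (Finset (Fin n))) : Preorder (PathClass n k J) where
  le := Relation.ReflTransGen (fun r r' => ∃ X, PathClass.FlipUp X r r')
  le_refl _ := Relation.ReflTransGen.refl
  le_trans _ _ _ := Relation.ReflTransGen.trans

/-- The second Bruhat order of a realizable `k`-set `J`: classes of paths from `∅` to `J` in
`B(n,k-1)`, with the Manin–Schechtman order. -/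
abbrev SecondBruhatOrder (n k : ℕ) (J : Finset (Finset (Fin n))) : Type :=
  PathClass n (k - 1) J

end HigherBruhat

namespace HigherBruhat

/-! Call a family of sets of one size consistent (`Cons`) if it meets every packet in an initial or
a final segment. A family `U` of `m`-sets orients each of their packets, lexicographically or
antilexicographically, and `U` is consistent exactly when the resulting relation `Step m U` is
acyclic (`Cons.exists_rank`, `cons_of_rank`).

Classes in `B(n,j)` are determined by their inversion sets, which are consistent, so a path to `J`
is the same as an order on `J` all of whose prefixes are consistent (`IsBuildOrder`). The inversion
set of a path is consistent and lies between `J_s` and `J_s ∪ J_F` (`IsBuildOrder.between`).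
Conversely, for every such `U` (`Between`) the family `J` is closed under predecessors for `Step U`;
the linear extensions of `Step U` on `J` are then paths with inversion set `U`, and any two of them
are connected by swaps. Classes of paths thus correspond to the sets `U`, and a flip adds one full
packet to `U` (`PathClass.FlipUp.inv_eq`, `PathClass.flipUp_of_inv_eq`). Hence the order refines
inclusion and is antisymmetric, and both bounds `J_s` and `J_s ∪ J_F` occur because they are
consistent.

It remains to see that no other `U` is extremal. For consistent `V ⊆ T` both are closed under
predecessors for `Step (sfxUnion V T)`; if `sfxUnion V T` is consistent, a rank function lets one
element of `T \ V` be removed from `T` or added to `V`. Consistency of the union holds for the pairs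
`J_s ⊆ U` and `U ⊆ J_s ∪ J_F`, because there the members of `T \ V` have their whole packet in `J`
(`cons_sfxUnion_sfx`, `cons_sfxUnion_top`). -/

/-! ### Consistency and acyclicity. -/

/-- `U` restricted to `m`-subsets of `E` meets every packet of an `(m+1)`-subset of `E` in an initial
or a final segment. -/
def Cons {n : ℕ} (E : Finset (Fin n)) (m : ℕ) (U : Set (Finset (Fin n))) : Prop :=
  ∀ Y ⊆ E, Y.card = m + 1 →
    MonotoneOn (fun x => Y.erase x ∈ U) Y ∨ AntitoneOn (fun x => Y.erase x ∈ U) Y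

/-- `A` and `B` lie in the packet of an `m`-set `X`, and `A` precedes `B` in the antilexicographic
order if `X ∈ U`, in the lexicographic order otherwise. -/
def Step {n : ℕ} (m : ℕ) (U : Set (Finset (Fin n))) (A B : Finset (Fin n)) : Prop :=
  ∃ X x y, X.card = m ∧ x ∈ X ∧ y ∈ X ∧ A = X.erase x ∧ B = X.erase y ∧
    (X ∈ U → x < y) ∧ (X ∉ U → y < x)

/-- `J` is closed under predecessors for `Step m U`. -/
def Low {n : ℕ} (m : ℕ) (U J : Set (Finset (Fin n))) : Prop :=
  ∀ A B, Step m U A B → B ∈ J → A ∈ J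

variable {n : ℕ}

/-- Contraction half of the deletion–contraction induction in `exists_rank_aux`: the packet of `Y`,
with `a` put into each member, is the packet of `insert a Y` without its member `Y`. -/
theorem Cons.contract {E : Finset (Fin n)} {m : ℕ} {U : Set (Finset (Fin n))} {a : Fin n}
    (ha : ∀ x ∈ E, x < a) (h : Cons (insert a E) (m + 1) U) :
    Cons E m {A | insert a A ∈ U} := by
  intro Y hY hc
  have haY : a ∉ Y := fun h => lt_irrefl _ (ha a (hY h))
  have key : ∀ x ∈ Y, (insert a Y).erase x = insert a (Y.erase x) := by
    intro x hx
    rw [Finset.erase_insert_of_ne]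
    rintro rfl; exact haY hx
  refine (h (insert a Y) (Finset.insert_subset_insert _ hY)
    (by rw [Finset.card_insert_of_notMem haY, hc])).imp ?_ ?_
  · intro hm x hx y hy hxy
    have := hm (Finset.mem_insert_of_mem hx) (Finset.mem_insert_of_mem hy) hxy
    simpa only [key x hx, key y hy, Set.mem_ofPred_eq] using this
  · intro hm x hx y hy hxy
    have := hm (Finset.mem_insert_of_mem hx) (Finset.mem_insert_of_mem hy) hxy
    simpa only [key x hx, key y hy, Set.mem_ofPred_eq] using this

/-- Induction on the largest element `a` of the ground set. Deletion ranks the sets avoiding `a`,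
contraction those containing `a`. A set `A` avoiding `a` must come before or after the other members
of the packet of `insert a A`, all of which contain `a`, according to whether `insert a A` is in
`U`. -/
theorem exists_rank_aux (E : Finset (Fin n)) : ∀ (m : ℕ) (U : Set (Finset (Fin n))), Cons E m U →
    ∃ f : Finset (Fin n) → ℕ, ∀ X ⊆ E, X.card = m → ∀ x ∈ X, ∀ y ∈ X,
      (X ∈ U → x < y) → (X ∉ U → y < x) → f (X.erase x) < f (X.erase y) := by
  classical
  induction E using Finset.induction_on_max with
  | empty =>
    intro m U _
    refine ⟨fun _ => 0, fun X hX _ x hx => ?_⟩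
    simpa using hX hx
  | insert a E ha ih =>
    intro m U hU
    rcases m with _ | m
    · refine ⟨fun _ => 0, fun X hX hc x hx => ?_⟩
      rw [Finset.card_eq_zero] at hc
      simp [hc] at hx
    have haE : a ∉ E := fun h => lt_irrefl _ (ha a h)
    have hdel : Cons E (m + 1) U := fun Y hY => hU Y (hY.trans (Finset.subset_insert _ _))
    obtain ⟨f₁, h₁⟩ := ih (m + 1) U hdel
    obtain ⟨f₂, h₂⟩ := ih m _ (Cons.contract ha hU)
    obtain ⟨N, hN⟩ : ∃ N, ∀ A, f₁ A < N ∧ f₂ A < N := by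
      refine ⟨Finset.univ.sup f₁ + Finset.univ.sup f₂ + 1, fun A => ?_⟩
      have e₁ := Finset.le_sup (f := f₁) (Finset.mem_univ A)
      have e₂ := Finset.le_sup (f := f₂) (Finset.mem_univ A)
      omega
    -- Three blocks of ranks: `[0, N)` for sets `A` without `a` with `insert a A ∉ U`, `[N, 2N)` for
    -- sets with `a`, and ranks from `2N` on for the remaining sets.
    refine ⟨fun A => if a ∈ A then N + f₂ (A.erase a) else
      if insert a A ∈ U then 2 * N + f₁ A else f₁ A, ?_⟩
    intro X hX hc x hx y hy hin hout
    by_cases haX : a ∈ X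
    · have hmax : ∀ z ∈ X, z ≤ a := by
        intro z hz
        rcases Finset.mem_insert.1 (hX hz) with rfl | hz
        · exact le_rfl
        · exact (ha z hz).le
      have hxy : x ≠ y := by
        rintro rfl
        by_cases h : X ∈ U
        · exact lt_irrefl _ (hin h)
        · exact lt_irrefl _ (hout h)
      by_cases hxa : x = a
      · subst hxa
        have hXU : X ∉ U := fun h => absurd (hin h) (not_lt.2 (hmax y hy))
        have : x ∈ X.erase y := Finset.mem_erase.2 ⟨hxy, hx⟩
        simp only [Finset.notMem_erase, Finset.insert_erase hx, hXU, this, if_true, if_false]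
        have := (hN (X.erase x)).1
        omega
      by_cases hya : y = a
      · subst hya
        have hXU : X ∈ U := by
          by_contra h
          exact absurd (hout h) (not_lt.2 (hmax x hx))
        have : y ∈ X.erase x := Finset.mem_erase.2 ⟨Ne.symm hxy, hy⟩
        simp only [Finset.notMem_erase, Finset.insert_erase hy, hXU, this, if_true, if_false]
        have := (hN ((X.erase x).erase y)).2
        omega
      · have e₁ : a ∈ X.erase x := Finset.mem_erase.2 ⟨Ne.symm hxa, haX⟩
        have e₂ : a ∈ X.erase y := Finset.mem_erase.2 ⟨Ne.symm hya, haX⟩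
        simp only [e₁, e₂, if_true]
        have := h₂ (X.erase a) (by
            intro z hz
            rw [Finset.mem_erase] at hz
            exact (Finset.mem_insert.1 (hX hz.2)).resolve_left hz.1)
          (by rw [Finset.card_erase_of_mem haX, hc]; rfl) x (Finset.mem_erase.2 ⟨hxa, hx⟩)
          y (Finset.mem_erase.2 ⟨hya, hy⟩)
          (by simpa [Finset.insert_erase haX] using hin)
          (by simpa [Finset.insert_erase haX] using hout)
        rw [Finset.erase_right_comm, Finset.erase_right_comm (a := a)] at this
        omega
    · have hXE : X ⊆ E := fun z hz => (Finset.mem_insert.1 (hX hz)).resolve_left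
        (by rintro rfl; exact haX hz)
      have key := h₁ X hXE hc x hx y hy hin hout
      have e₁ : a ∉ X.erase x := fun h => haX (Finset.mem_of_mem_erase h)
      have e₂ : a ∉ X.erase y := fun h => haX (Finset.mem_of_mem_erase h)
      have hya : y < a := ha y (hXE hy)
      have hxa : x < a := ha x (hXE hx)
      have c₁ : (insert a X).erase x = insert a (X.erase x) := Finset.erase_insert_of_ne hxa.ne'
      have c₂ : (insert a X).erase y = insert a (X.erase y) := Finset.erase_insert_of_ne hya.ne'
      have c₃ : (insert a X).erase a = X := Finset.erase_insert haX
      -- A step never leads from the top block down to the bottom one. In the packet of `insert a X`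
      -- the set `X` is the member with the largest erased index, so its membership in `U`
      -- constrains the segment in the direction of the step.
      have hup : insert a (X.erase x) ∈ U → insert a (X.erase y) ∈ U := by
        rw [← c₁, ← c₂]
        intro h
        have mx : x ∈ insert a X := Finset.mem_insert_of_mem hx
        have my : y ∈ insert a X := Finset.mem_insert_of_mem hy
        have ma : a ∈ insert a X := Finset.mem_insert_self _ _
        rcases hU (insert a X) (Finset.insert_subset_insert _ hXE)
          (by rw [Finset.card_insert_of_notMem haX, hc]) with hm | hm
        · have : X ∈ U := by
            have := hm mx ma hxa.le h
            simpa only [c₃] using this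
          exact hm mx my (hin this).le h
        · by_cases hXU : X ∈ U
          · exact hm my ma hya.le (by simpa only [c₃] using hXU)
          · exact hm my mx (hout hXU).le h
      simp only [e₁, e₂, if_false]
      have := (hN (X.erase x)).1
      split_ifs with i₁ i₂
      · omega
      · exact absurd (hup i₁) i₂
      · omega
      · omega

theorem Cons.exists_rank {m : ℕ} {U : Set (Finset (Fin n))} (h : Cons Finset.univ m U) :
    ∃ f : Finset (Fin n) → ℕ, ∀ A B, Step m U A B → f A < f B := by
  obtain ⟨f, hf⟩ := exists_rank_aux _ m U h
  refine ⟨f, ?_⟩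
  rintro _ _ ⟨X, x, y, hc, hx, hy, rfl, rfl, h₁, h₂⟩
  exact hf X (Finset.subset_univ _) hc x hx y hy h₁ h₂

/-- A family of `m`-sets whose `Step` relation is acyclic is consistent. -/
theorem cons_of_rank {m : ℕ} {U : Set (Finset (Fin n))} (f : Finset (Fin n) → ℕ)
    (hf : ∀ A B, A.card + 1 = m → B.card + 1 = m → Step m U A B → f A < f B) :
    Cons Finset.univ m U := by
  intro Y _ hc
  by_contra hcon
  rw [not_or, Set.monotoneOn_iff_monotone, Set.antitoneOn_iff_antitone,
    not_monotone_not_antitone_iff_exists_lt_lt] at hcon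
  obtain ⟨⟨a, ha⟩, ⟨b, hb⟩, ⟨c, hcc⟩, hab, hbc, hcon⟩ := hcon
  change a < b at hab
  change b < c at hbc
  have step : ∀ z x y, z ∈ Y → x ∈ Y → y ∈ Y → x ≠ z → y ≠ z → (Y.erase z ∈ U → x < y) →
      (Y.erase z ∉ U → y < x) → f ((Y.erase z).erase x) < f ((Y.erase z).erase y) := by
    intro z x y hz hx hy hxz hyz h₁ h₂
    have hx' : x ∈ Y.erase z := Finset.mem_erase.2 ⟨hxz, hx⟩
    have hy' : y ∈ Y.erase z := Finset.mem_erase.2 ⟨hyz, hy⟩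
    have hc' : (Y.erase z).card = m := by rw [Finset.card_erase_of_mem hz, hc]; rfl
    have hp := Finset.card_pos.2 ⟨x, hx'⟩
    refine hf _ _ ?_ ?_ ⟨Y.erase z, x, y, hc', hx', hy', rfl, rfl, h₁, h₂⟩
    · rw [Finset.card_erase_of_mem hx']; omega
    · rw [Finset.card_erase_of_mem hy']; omega
  have hac := hab.trans hbc
  rw [Finset.mem_coe] at ha hb hcc
  simp only [lt_iff_le_not_ge, le_Prop_eq, Classical.not_imp] at hcon
  -- Failure of consistency gives three members of the packet of `Y` alternating between in and out
  -- of `U`. Their packets orient the three pairwise intersections cyclically.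
  rcases hcon with ⟨⟨_, h₁, h₂⟩, ⟨_, _, h₃⟩⟩ | ⟨⟨_, h₁, h₂⟩, ⟨_, h₃, _⟩⟩
  · have s₁ := step a c b ha hcc hb hac.ne' hab.ne' (fun h => absurd h h₂) (fun _ => hbc)
    have s₂ := step b a c hb ha hcc hab.ne hbc.ne' (fun _ => hac) (fun h => absurd h₁ h)
    have s₃ := step c b a hcc hb ha hbc.ne hac.ne (fun h => absurd h h₃) (fun _ => hab)
    rw [Finset.erase_right_comm (a := b) (b := a)] at s₂
    rw [Finset.erase_right_comm (a := c) (b := b), Finset.erase_right_comm (a := c) (b := a)] at s₃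
    omega
  · have s₁ := step a b c ha hb hcc hab.ne' hac.ne' (fun _ => hbc) (fun h => absurd h₁ h)
    have s₂ := step b c a hb hcc ha hbc.ne' hab.ne (fun h => absurd h h₂) (fun _ => hac)
    have s₃ := step c a b hcc ha hb hac.ne hbc.ne (fun _ => hab) (fun h => absurd h₃ h)
    rw [Finset.erase_right_comm (a := b) (b := a)] at s₂
    rw [Finset.erase_right_comm (a := c) (b := b), Finset.erase_right_comm (a := c) (b := a)] at s₃
    omega

/-! ### Families closed under predecessors. -/

/-- `Step` orders each packet totally, lexicographically or antilexicographically, so a family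
closed under predecessors cuts it in a final or an initial segment. -/
theorem Low.cons {m : ℕ} {U J : Set (Finset (Fin n))} (h : Low (m + 1) U J) :
    Cons Finset.univ m J := by
  intro X _ hc
  by_cases hX : X ∈ U
  · right
    intro x hx y hy hxy hJ
    rcases hxy.eq_or_lt with rfl | hxy
    · exact hJ
    · exact h _ _ ⟨X, x, y, hc, hx, hy, rfl, rfl, fun _ => hxy, fun h => absurd hX h⟩ hJ
  · left
    intro x hx y hy hxy hJ
    rcases hxy.eq_or_lt with rfl | hxy
    · exact hJ
    · exact h _ _ ⟨X, y, x, hc, hy, hx, rfl, rfl, fun h => absurd h hX, fun _ => hxy⟩ hJ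

theorem Step.card_left {m : ℕ} {U : Set (Finset (Fin n))} {A B : Finset (Fin n)}
    (h : Step (m + 1) U A B) : A.card = m := by
  obtain ⟨X, x, y, hc, hx, hy, rfl, rfl, -, -⟩ := h
  rw [Finset.card_erase_of_mem hx, hc]; rfl

theorem Step.card_right {m : ℕ} {U : Set (Finset (Fin n))} {A B : Finset (Fin n)}
    (h : Step (m + 1) U A B) : B.card = m := by
  obtain ⟨X, x, y, hc, hx, hy, rfl, rfl, -, -⟩ := h
  rw [Finset.card_erase_of_mem hy, hc]; rfl

/-- If `V ⊂ T` are closed under predecessors for an acyclic `Step` relation, then one can remove an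
element of `T \ V` from `T`, keeping consistency. -/
theorem exists_cons_erase {m : ℕ} {W V T : Set (Finset (Fin n))} (hW : Cons Finset.univ (m + 1) W)
    (hV : Low (m + 1) W V) (hT : Low (m + 1) W T) {X₀ : Finset (Fin n)} (hc : X₀.card = m)
    (h₁ : X₀ ∈ T) (h₂ : X₀ ∉ V) :
    ∃ X ∈ T, X ∉ V ∧ X.card = m ∧ Cons Finset.univ m (T \ {X}) := by
  obtain ⟨f, hf⟩ := hW.exists_rank
  -- An element of maximal rank in `T \ V` precedes nothing in `T`: a successor in `V` would force
  -- it into `V`, and one in `T \ V` would have larger rank.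
  obtain ⟨X, ⟨hX₁, hX₂, hX₃⟩, hmax⟩ := Set.exists_max_image _ f
    (Set.toFinite {X | X ∈ T ∧ X ∉ V ∧ X.card = m}) ⟨X₀, h₁, h₂, hc⟩
  refine ⟨X, hX₁, hX₂, hX₃, Low.cons (U := W) ?_⟩
  rintro A B hAB ⟨hB, -⟩
  refine ⟨hT A B hAB hB, ?_⟩
  rintro rfl
  have hBV : B ∉ V := fun h => hX₂ (hV _ _ hAB h)
  exact absurd (hf _ _ hAB) (not_lt.2 (hmax B ⟨hB, hBV, hAB.card_right⟩))

/-- If `V ⊂ T` are closed under predecessors for an acyclic `Step` relation, then one can add an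
element of `T \ V` to `V`, keeping consistency. -/
theorem exists_cons_insert {m : ℕ} {W V T : Set (Finset (Fin n))} (hW : Cons Finset.univ (m + 1) W)
    (hV : Low (m + 1) W V) (hT : Low (m + 1) W T) {X₀ : Finset (Fin n)} (hc : X₀.card = m)
    (h₁ : X₀ ∈ T) (h₂ : X₀ ∉ V) :
    ∃ X ∈ T, X ∉ V ∧ X.card = m ∧ Cons Finset.univ m (insert X V) := by
  obtain ⟨f, hf⟩ := hW.exists_rank
  obtain ⟨X, ⟨hX₁, hX₂, hX₃⟩, hmin⟩ := Set.exists_min_image _ f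
    (Set.toFinite {X | X ∈ T ∧ X ∉ V ∧ X.card = m}) ⟨X₀, h₁, h₂, hc⟩
  refine ⟨X, hX₁, hX₂, hX₃, Low.cons (U := W) ?_⟩
  rintro A B hAB (rfl | hB)
  · by_contra hA
    rw [Set.mem_insert_iff, not_or] at hA
    exact absurd (hf _ _ hAB) (not_lt.2 (hmin A ⟨hT _ _ hAB hX₁, hA.2, hAB.card_left⟩))
  · exact Or.inr (hV _ _ hAB hB)

/-! ### The ends of a packet; consistency of `J_s` and `J_s ∪ J_F`. -/

/-- `X` without its smallest element. -/
def dmin (X : Finset (Fin n)) : Finset (Fin n) := X.filter (fun x => ∃ y ∈ X, y < x)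

/-- `X` without its largest element. -/
def dmax (X : Finset (Fin n)) : Finset (Fin n) := X.filter (fun x => ∃ y ∈ X, x < y)

theorem dmin_eq {X : Finset (Fin n)} {a : Fin n} (ha : IsLeast (X : Set (Fin n)) a) :
    dmin X = X.erase a := by
  ext x
  simp only [dmin, Finset.mem_filter, Finset.mem_erase]
  constructor
  · rintro ⟨hx, y, hy, hyx⟩
    exact ⟨((ha.2 hy).trans_lt hyx).ne', hx⟩
  · rintro ⟨hxa, hx⟩
    exact ⟨hx, a, ha.1, lt_of_le_of_ne (ha.2 hx) (Ne.symm hxa)⟩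

theorem dmax_eq {X : Finset (Fin n)} {a : Fin n} (ha : IsGreatest (X : Set (Fin n)) a) :
    dmax X = X.erase a := by
  ext x
  simp only [dmax, Finset.mem_filter, Finset.mem_erase]
  constructor
  · rintro ⟨hx, y, hy, hyx⟩
    exact ⟨(hyx.trans_le (ha.2 hy)).ne, hx⟩
  · rintro ⟨hxa, hx⟩
    exact ⟨hx, a, ha.1, lt_of_le_of_ne (ha.2 hx) hxa⟩

theorem exists_isLeast {X : Finset (Fin n)} (h : X.Nonempty) :
    ∃ a, IsLeast (X : Set (Fin n)) a := ⟨_, X.isLeast_min' h⟩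

theorem exists_isGreatest {X : Finset (Fin n)} (h : X.Nonempty) :
    ∃ a, IsGreatest (X : Set (Fin n)) a := ⟨_, X.isGreatest_max' h⟩

theorem IsLeast.erase {X : Finset (Fin n)} {a b : Fin n} (h : IsLeast (X : Set (Fin n)) a)
    (hab : a ≠ b) : IsLeast (X.erase b : Set (Fin n)) a :=
  ⟨by simpa [hab] using h.1, fun x hx => h.2 (by simpa using (Finset.mem_of_mem_erase hx))⟩

theorem IsGreatest.erase {X : Finset (Fin n)} {a b : Fin n} (h : IsGreatest (X : Set (Fin n)) a)
    (hab : a ≠ b) : IsGreatest (X.erase b : Set (Fin n)) a :=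
  ⟨by simpa [hab] using h.1, fun x hx => h.2 (by simpa using (Finset.mem_of_mem_erase hx))⟩

/-- Removing the smallest element from the members of a packet is monotone or antitone in a
consistent family, according to whether the family contains the set without both ends. -/
theorem Cons.dmin_mono {m : ℕ} {J : Set (Finset (Fin n))} (hJ : Cons Finset.univ m J)
    {Y : Finset (Fin n)} (hY : Y.card = m + 2) :
    (dmax (dmin Y) ∈ J → MonotoneOn (fun x => dmin (Y.erase x) ∈ J) Y) ∧
    (dmax (dmin Y) ∉ J → AntitoneOn (fun x => dmin (Y.erase x) ∈ J) Y) := by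
  obtain ⟨a, ha⟩ := exists_isLeast (Finset.card_pos.1 (by omega : 0 < Y.card))
  have hc : (Y.erase a).card = m + 1 := by rw [Finset.card_erase_of_mem ha.1, hY]; rfl
  have hne : (Y.erase a).Nonempty := Finset.card_pos.1 (by omega)
  obtain ⟨b, hb⟩ := exists_isLeast hne
  obtain ⟨M, hM⟩ := exists_isGreatest hne
  rw [dmin_eq ha, dmax_eq hM]
  -- The sets `dmin (Y.erase x)`, for `x` in `Y`, run through the packet of `Y.erase a` with one end
  -- repeated: the indices `a` and `b` give the same set.
  have e₁ : ∀ x, a ≠ x → dmin (Y.erase x) = (Y.erase a).erase x := fun x hx => by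
    rw [dmin_eq (IsLeast.erase ha hx), Finset.erase_right_comm]
  have e₂ : dmin (Y.erase a) = (Y.erase a).erase b := dmin_eq hb
  have mem : ∀ {x}, x ∈ Y → a ≠ x → x ∈ Y.erase a := fun hx h => Finset.mem_erase.2 ⟨h.symm, hx⟩
  have hmono := hJ (Y.erase a) (Finset.subset_univ _) hc
  constructor
  · intro h
    -- Membership of the set with the largest index erased fixes the direction: if it is in `J`, an
    -- antitone pattern is constantly true.
    have hm : MonotoneOn (fun x => (Y.erase a).erase x ∈ J) (Y.erase a) := by
      refine hmono.elim id fun hanti => ?_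
      intro x hx y hy _ _
      exact hanti hy hM.1 (hM.2 hy) h
    intro x hx y hy hxy
    by_cases hxa : a = x
    · subst hxa
      by_cases hya : a = y
      · subst hya; exact le_rfl
      · simp only [e₁ y hya, e₂]
        exact hm hb.1 (mem hy hya) (hb.2 (mem hy hya))
    · have hya : a ≠ y := by
        rintro rfl
        exact hxa (le_antisymm (ha.2 hx) hxy)
      simp only [e₁ x hxa, e₁ y hya]
      exact hm (mem hx hxa) (mem hy hya) hxy
  · intro h
    have hm : AntitoneOn (fun x => (Y.erase a).erase x ∈ J) (Y.erase a) := by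
      refine hmono.elim (fun hanti => ?_) id
      intro x hx y hy _ hh
      exact absurd (hanti hy hM.1 (hM.2 hy) hh) h
    intro x hx y hy hxy
    by_cases hxa : a = x
    · subst hxa
      by_cases hya : a = y
      · subst hya; exact le_rfl
      · simp only [e₁ y hya, e₂]
        exact hm hb.1 (mem hy hya) (hb.2 (mem hy hya))
    · have hya : a ≠ y := by
        rintro rfl
        exact hxa (le_antisymm (ha.2 hx) hxy)
      simp only [e₁ x hxa, e₁ y hya]
      exact hm (mem hx hxa) (mem hy hya) hxy

theorem dmax_dmin_eq {Y : Finset (Fin n)} (hY : 2 ≤ Y.card) : dmax (dmin Y) = dmin (dmax Y) := by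
  obtain ⟨a, ha⟩ := exists_isLeast (Finset.card_pos.1 (by omega : 0 < Y.card))
  obtain ⟨M, hM⟩ := exists_isGreatest (Finset.card_pos.1 (by omega : 0 < Y.card))
  have haM : a ≠ M := by
    rintro rfl
    have : Y ⊆ {a} := fun x hx => by
      rw [Finset.mem_singleton]; exact le_antisymm (hM.2 hx) (ha.2 hx)
    have := Finset.card_le_card this
    simp at this
    omega
  rw [dmin_eq ha, dmax_eq hM, dmax_eq (IsGreatest.erase hM haM.symm), dmin_eq (IsLeast.erase ha haM),
    Finset.erase_right_comm]

/-- Removing the largest element, as in `Cons.dmin_mono`. -/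
theorem Cons.dmax_mono {m : ℕ} {J : Set (Finset (Fin n))} (hJ : Cons Finset.univ m J)
    {Y : Finset (Fin n)} (hY : Y.card = m + 2) :
    (dmax (dmin Y) ∈ J → AntitoneOn (fun x => dmax (Y.erase x) ∈ J) Y) ∧
    (dmax (dmin Y) ∉ J → MonotoneOn (fun x => dmax (Y.erase x) ∈ J) Y) := by
  rw [dmax_dmin_eq (by omega)]
  obtain ⟨a, ha⟩ := exists_isGreatest (Finset.card_pos.1 (by omega : 0 < Y.card))
  have hc : (Y.erase a).card = m + 1 := by rw [Finset.card_erase_of_mem ha.1, hY]; rfl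
  have hne : (Y.erase a).Nonempty := Finset.card_pos.1 (by omega)
  obtain ⟨b, hb⟩ := exists_isGreatest hne
  obtain ⟨M, hM⟩ := exists_isLeast hne
  rw [dmax_eq ha, dmin_eq hM]
  have e₁ : ∀ x, a ≠ x → dmax (Y.erase x) = (Y.erase a).erase x := fun x hx => by
    rw [dmax_eq (IsGreatest.erase ha hx), Finset.erase_right_comm]
  have e₂ : dmax (Y.erase a) = (Y.erase a).erase b := dmax_eq hb
  have mem : ∀ {x}, x ∈ Y → a ≠ x → x ∈ Y.erase a := fun hx h => Finset.mem_erase.2 ⟨h.symm, hx⟩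
  have hmono := hJ (Y.erase a) (Finset.subset_univ _) hc
  constructor
  · intro h
    have hm : AntitoneOn (fun x => (Y.erase a).erase x ∈ J) (Y.erase a) := by
      refine hmono.elim (fun hmon => ?_) id
      intro x hx y hy _ _
      exact hmon hM.1 hx (hM.2 hx) h
    intro x hx y hy hxy
    by_cases hya : a = y
    · subst hya
      by_cases hxa : a = x
      · subst hxa; exact le_rfl
      · simp only [e₁ x hxa, e₂]
        exact hm (mem hx hxa) hb.1 (hb.2 (mem hx hxa))
    · have hxa : a ≠ x := by
        rintro rfl
        exact hya (le_antisymm hxy (ha.2 hy))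
      simp only [e₁ x hxa, e₁ y hya]
      exact hm (mem hx hxa) (mem hy hya) hxy
  · intro h
    have hm : MonotoneOn (fun x => (Y.erase a).erase x ∈ J) (Y.erase a) := by
      refine hmono.elim id fun hanti => ?_
      intro x hx y hy _ hh
      exact absurd (hanti hM.1 hx (hM.2 hx) hh) h
    intro x hx y hy hxy
    by_cases hya : a = y
    · subst hya
      by_cases hxa : a = x
      · subst hxa; exact le_rfl
      · simp only [e₁ x hxa, e₂]
        exact hm (mem hx hxa) hb.1 (hb.2 (mem hx hxa))
    · have hxa : a ≠ x := by
        rintro rfl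
        exact hya (le_antisymm hxy (ha.2 hy))
      simp only [e₁ x hxa, e₁ y hya]
      exact hm (mem hx hxa) (mem hy hya) hxy

/-- The sets whose packet meets `J` in a proper final segment, by the ends of the packet. -/
def sfx (J : Set (Finset (Fin n))) : Set (Finset (Fin n)) := {X | dmin X ∈ J ∧ dmax X ∉ J}

/-- The sets whose packet meets `J` in a nonempty final segment, by the last member. -/
def top (J : Set (Finset (Fin n))) : Set (Finset (Fin n)) := {X | dmin X ∈ J}

/-- The conditions `dmin ∈ J` and `dmax ∉ J` vary in the same direction along the packet of `Y`, and
that direction is decided by the single set `dmax (dmin Y)`. -/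
theorem Cons.sfx_mono {m : ℕ} {J : Set (Finset (Fin n))} (hJ : Cons Finset.univ m J)
    {Y : Finset (Fin n)} (hY : Y.card = m + 2) :
    (dmax (dmin Y) ∈ J → MonotoneOn (fun x => Y.erase x ∈ sfx J) Y) ∧
    (dmax (dmin Y) ∉ J → AntitoneOn (fun x => Y.erase x ∈ sfx J) Y) := by
  constructor
  · intro h x hx y hy hxy hh
    exact ⟨(hJ.dmin_mono hY).1 h hx hy hxy hh.1, fun hc => hh.2 ((hJ.dmax_mono hY).1 h hx hy hxy hc)⟩
  · intro h x hx y hy hxy hh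
    exact ⟨(hJ.dmin_mono hY).2 h hx hy hxy hh.1, fun hc => hh.2 ((hJ.dmax_mono hY).2 h hx hy hxy hc)⟩

theorem Cons.sfx {m : ℕ} {J : Set (Finset (Fin n))} (hJ : Cons Finset.univ m J) :
    Cons Finset.univ (m + 1) (sfx J) := by
  intro Y _ hY
  by_cases h : dmax (dmin Y) ∈ J
  · exact Or.inl ((hJ.sfx_mono hY).1 h)
  · exact Or.inr ((hJ.sfx_mono hY).2 h)

theorem Cons.top {m : ℕ} {J : Set (Finset (Fin n))} (hJ : Cons Finset.univ m J) :
    Cons Finset.univ (m + 1) (top J) := by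
  intro Y _ hY
  by_cases h : dmax (dmin Y) ∈ J
  · exact Or.inl ((hJ.dmin_mono hY).1 h)
  · exact Or.inr ((hJ.dmin_mono hY).2 h)

/-- A consistent `J` is closed under predecessors for every `U` which orders the proper packets as
they are met by `J`. -/
theorem Cons.low {m : ℕ} {J U : Set (Finset (Fin n))} (hJ : Cons Finset.univ m J)
    (h₁ : ∀ X, X.card = m + 1 → X ∈ HigherBruhat.sfx J → X ∈ U)
    (h₂ : ∀ X, X.card = m + 1 → dmin X ∉ J → dmax X ∈ J → X ∉ U) : Low (m + 1) U J := by
  rintro _ _ ⟨X, x, y, hc, hx, hy, rfl, rfl, hin, hout⟩ hB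
  obtain ⟨a, ha⟩ := exists_isLeast ⟨x, hx⟩
  obtain ⟨M, hM⟩ := exists_isGreatest ⟨x, hx⟩
  have g₁ := h₁ X hc
  have g₂ := h₂ X hc
  simp only [HigherBruhat.sfx, Set.mem_ofPred_eq, dmin_eq ha, dmax_eq hM] at g₁ g₂
  rcases hJ X (Finset.subset_univ _) hc with hm | hm
  · have hMJ : X.erase M ∈ J := hm hy hM.1 (hM.2 hy) hB
    by_cases haJ : X.erase a ∈ J
    · exact hm ha.1 hx (ha.2 hx) haJ
    · exact hm hy hx (hout (g₂ haJ hMJ)).le hB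
  · have haJ : X.erase a ∈ J := hm ha.1 hy (ha.2 hy) hB
    by_cases hMJ : X.erase M ∈ J
    · exact hm hx hM.1 (hM.2 hx) hMJ
    · exact hm hx hy (hin (g₁ ⟨haJ, hMJ⟩)).le hB

/-! ### One orientation for a nested pair `V ⊆ T`. -/

/-- A family which orders the packets as they are met by both `V` and `T`, when `V ⊆ T`. -/
def sfxUnion (V T : Set (Finset (Fin n))) : Set (Finset (Fin n)) := HigherBruhat.sfx T ∪ HigherBruhat.sfx V

/-- By `Cons.low` only packets met in a proper initial segment need checking. If `V` or `T` meets a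
packet so, the inclusion `V ⊆ T`, applied to the ends of the packet, keeps it out of both `sfx V`
and `sfx T`. -/
theorem low_sfxUnion {m : ℕ} {V T : Set (Finset (Fin n))} (hVT : ∀ X, X.card = m → X ∈ V → X ∈ T)
    (hV : Cons Finset.univ m V) (hT : Cons Finset.univ m T) :
    Low (m + 1) (sfxUnion V T) V ∧ Low (m + 1) (sfxUnion V T) T := by
  have key : ∀ X : Finset (Fin n), X.card = m + 1 → (dmin X ∈ V → dmin X ∈ T) ∧
      (dmax X ∈ V → dmax X ∈ T) := by
    intro X hc
    have hne : X.Nonempty := Finset.card_pos.1 (by omega)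
    obtain ⟨a, ha⟩ := exists_isLeast hne
    obtain ⟨M, hM⟩ := exists_isGreatest hne
    rw [dmin_eq ha, dmax_eq hM]
    refine ⟨hVT _ ?_, hVT _ ?_⟩
    · rw [Finset.card_erase_of_mem ha.1, hc]; rfl
    · rw [Finset.card_erase_of_mem hM.1, hc]; rfl
  refine ⟨hV.low (fun X _ h => Or.inr h) ?_, hT.low (fun X _ h => Or.inl h) ?_⟩
  · rintro X hc h₁ h₂ (h | h)
    · exact h.2 ((key X hc).2 h₂)
    · exact h₁ h.1
  · rintro X hc h₁ h₂ (h | h)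
    · exact h₁ h.1
    · exact h₁ ((key X hc).1 h.1)

theorem card_dmin {X : Finset (Fin n)} {m : ℕ} (h : X.card = m + 1) : (dmin X).card = m := by
  obtain ⟨a, ha⟩ := exists_isLeast (Finset.card_pos.1 (by omega : 0 < X.card))
  rw [dmin_eq ha, Finset.card_erase_of_mem ha.1, h]; rfl

theorem card_dmax {X : Finset (Fin n)} {m : ℕ} (h : X.card = m + 1) : (dmax X).card = m := by
  obtain ⟨a, ha⟩ := exists_isGreatest (Finset.card_pos.1 (by omega : 0 < X.card))
  rw [dmax_eq ha, Finset.card_erase_of_mem ha.1, h]; rfl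

/-- By `Cons.sfx_mono` the two parts of the union vary in the same direction on the packet of `Z`
unless `dmax (dmin Z)` lies in `T \ V`. In that case the hypothesis makes one part miss the packet.
-/
theorem cons_sfxUnion {m : ℕ} {V T : Set (Finset (Fin n))} (hVT : ∀ X, X.card = m → X ∈ V → X ∈ T)
    (hV : Cons Finset.univ m V) (hT : Cons Finset.univ m T)
    (h : ∀ Z : Finset (Fin n), Z.card = m + 2 → dmax (dmin Z) ∈ T → dmax (dmin Z) ∉ V →
      (∀ x ∈ Z, Z.erase x ∉ HigherBruhat.sfx V) ∨ (∀ x ∈ Z, Z.erase x ∉ HigherBruhat.sfx T)) :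
    Cons Finset.univ (m + 1) (sfxUnion V T) := by
  intro Z _ hZ
  have hφ : (dmax (dmin Z)).card = m := card_dmax (card_dmin hZ)
  by_cases h₁ : dmax (dmin Z) ∈ V
  · left
    intro x hx y hy hxy
    exact Or.imp ((hT.sfx_mono hZ).1 (hVT _ hφ h₁) hx hy hxy) ((hV.sfx_mono hZ).1 h₁ hx hy hxy)
  by_cases h₂ : dmax (dmin Z) ∈ T
  · rcases h Z hZ h₂ h₁ with h | h
    · left
      intro x hx y hy hxy
      exact Or.imp ((hT.sfx_mono hZ).1 h₂ hx hy hxy) (fun hc => absurd hc (h x hx))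
    · right
      intro x hx y hy hxy
      exact Or.imp (fun hc => absurd hc (h y hy)) ((hV.sfx_mono hZ).2 h₁ hx hy hxy)
  · right
    intro x hx y hy hxy
    exact Or.imp ((hT.sfx_mono hZ).2 h₂ hx hy hxy) ((hV.sfx_mono hZ).2 h₁ hx hy hxy)

theorem dmin_mem_of_full {X : Finset (Fin n)} {J : Set (Finset (Fin n))} (hne : X.Nonempty)
    (h : ∀ x ∈ X, X.erase x ∈ J) : dmin X ∈ J := by
  obtain ⟨a, ha⟩ := exists_isLeast hne
  rw [dmin_eq ha]
  exact h a ha.1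

theorem dmax_mem_of_full {X : Finset (Fin n)} {J : Set (Finset (Fin n))} (hne : X.Nonempty)
    (h : ∀ x ∈ X, X.erase x ∈ J) : dmax X ∈ J := by
  obtain ⟨a, ha⟩ := exists_isGreatest hne
  rw [dmax_eq ha]
  exact h a ha.1

/-- In the conflicting case a member of `sfx (sfx J)` in the packet of `Z` would put `dmin (dmin Z)`
in `sfx J`, so `dmax (dmin (dmin Z)) ∉ J`. But that set is also `dmin` of `dmax (dmin Z)`, whose
whole packet is in `J`. -/
theorem cons_sfxUnion_sfx {m : ℕ} {J T : Set (Finset (Fin n))}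
    (hVT : ∀ X, X.card = m + 1 → X ∈ HigherBruhat.sfx J → X ∈ T)
    (hTJ : ∀ X, X.card = m + 1 → X ∈ T → X ∉ HigherBruhat.sfx J → ∀ x ∈ X, X.erase x ∈ J)
    (hJ : Cons Finset.univ m J) (hT : Cons Finset.univ (m + 1) T) :
    Cons Finset.univ (m + 2) (sfxUnion (HigherBruhat.sfx J) T) := by
  refine cons_sfxUnion hVT hJ.sfx hT fun Z hZ h₁ h₂ => Or.inl fun x hx hc => ?_
  have hφ : (dmax (dmin Z)).card = m + 1 := card_dmax (card_dmin hZ)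
  have hfull := hTJ _ hφ h₁ h₂
  obtain ⟨a, ha⟩ := exists_isLeast ⟨x, hx⟩
  have h₃ : dmin (Z.erase a) ∈ HigherBruhat.sfx J :=
    (hJ.sfx.dmin_mono hZ).2 h₂ ha.1 hx (ha.2 hx) hc.1
  rw [← dmin_eq ha] at h₃
  refine h₃.2 ?_
  rw [dmax_dmin_eq (by rw [card_dmin hZ]; omega)]
  exact dmin_mem_of_full (Finset.card_pos.1 (by omega)) hfull

/-- Mirror image of `cons_sfxUnion_sfx`: fullness of `dmax (dmin Z)` puts `dmax (dmax Z)` in `top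
J`, and monotonicity spreads this to every `dmax (Z.erase x)`. -/
theorem cons_sfxUnion_top {m : ℕ} {J V : Set (Finset (Fin n))}
    (hVT : ∀ X, X.card = m + 1 → X ∈ V → X ∈ HigherBruhat.top J)
    (hTJ : ∀ X, X.card = m + 1 → X ∈ HigherBruhat.top J → X ∉ V → ∀ x ∈ X, X.erase x ∈ J)
    (hJ : Cons Finset.univ m J) (hV : Cons Finset.univ (m + 1) V) :
    Cons Finset.univ (m + 2) (sfxUnion V (HigherBruhat.top J)) := by
  refine cons_sfxUnion hVT hV hJ.top fun Z hZ h₁ h₂ => Or.inr fun x hx hc => hc.2 ?_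
  have hφ : (dmax (dmin Z)).card = m + 1 := card_dmax (card_dmin hZ)
  have hfull := hTJ _ hφ h₁ h₂
  obtain ⟨a, ha⟩ := exists_isGreatest ⟨x, hx⟩
  refine (hJ.top.dmax_mono hZ).1 h₁ hx ha.1 (ha.2 hx) ?_
  change dmax (Z.erase a) ∈ HigherBruhat.top J
  rw [← dmax_eq ha]
  change dmin (dmax (dmax Z)) ∈ J
  rw [← dmax_dmin_eq (by rw [card_dmax hZ]; omega), ← dmax_dmin_eq (by omega)]
  exact dmax_mem_of_full (Finset.card_pos.1 (by omega)) hfull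

/-! ### Families between `J_s` and `J_s ∪ J_F`, and their one-element changes. -/

/-- The consistent families of `(m+1)`-sets lying between `sfx J` and `top J`. -/
structure Between (m : ℕ) (J U : Set (Finset (Fin n))) : Prop where
  base : Cons Finset.univ m J
  cons : Cons Finset.univ (m + 1) U
  sfx_sub : ∀ X, X.card = m + 1 → X ∈ HigherBruhat.sfx J → X ∈ U
  sub_top : ∀ X, X.card = m + 1 → X ∈ U → dmin X ∈ J

theorem Between.low {m : ℕ} {J U : Set (Finset (Fin n))} (h : Between m J U) :
    Low (m + 1) U J :=
  h.base.low h.sfx_sub fun X hc h₁ _ hX => h₁ (h.sub_top X hc hX)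

theorem Cons.full {m : ℕ} {J : Set (Finset (Fin n))} (hJ : Cons Finset.univ m J)
    {X : Finset (Fin n)} (hX : X.card = m + 1) (h₁ : dmin X ∈ J) (h₂ : dmax X ∈ J) :
    ∀ x ∈ X, X.erase x ∈ J := by
  intro x hx
  obtain ⟨a, ha⟩ := exists_isLeast ⟨x, hx⟩
  obtain ⟨M, hM⟩ := exists_isGreatest ⟨x, hx⟩
  rw [dmin_eq ha] at h₁
  rw [dmax_eq hM] at h₂
  rcases hJ X (Finset.subset_univ _) hX with hm | hm
  · exact hm ha.1 hx (ha.2 hx) h₁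
  · exact hm hx hM.1 (hM.2 hx) h₂

/-- The set removed is outside `J_s`, so the result still lies between the two bounds. -/
theorem Between.exists_erase {m : ℕ} {J U : Set (Finset (Fin n))} (h : Between m J U)
    {X₀ : Finset (Fin n)} (hc₀ : X₀.card = m + 1) (hX₀ : X₀ ∈ U) (hX₀' : X₀ ∉ HigherBruhat.sfx J) :
    ∃ X ∈ U, X ∉ HigherBruhat.sfx J ∧ X.card = m + 1 ∧ Cons Finset.univ (m + 1) (U \ {X}) := by
  have hTJ : ∀ X, X.card = m + 1 → X ∈ U → X ∉ HigherBruhat.sfx J → ∀ x ∈ X, X.erase x ∈ J := by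
    intro X hc hX hs
    have h₁ := h.sub_top X hc hX
    exact h.base.full hc h₁ (by by_contra h₂; exact hs ⟨h₁, h₂⟩)
  have hlow := low_sfxUnion h.sfx_sub h.base.sfx h.cons
  exact exists_cons_erase (cons_sfxUnion_sfx h.sfx_sub hTJ h.base h.cons) hlow.1 hlow.2
    hc₀ hX₀ hX₀'

theorem Between.exists_insert {m : ℕ} {J U : Set (Finset (Fin n))} (h : Between m J U)
    {X₀ : Finset (Fin n)} (hc₀ : X₀.card = m + 1) (hX₀ : X₀ ∈ HigherBruhat.top J) (hX₀' : X₀ ∉ U) :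
    ∃ X ∈ HigherBruhat.top J, X ∉ U ∧ X.card = m + 1 ∧ Cons Finset.univ (m + 1) (insert X U) := by
  have hTJ : ∀ X, X.card = m + 1 → X ∈ HigherBruhat.top J → X ∉ U → ∀ x ∈ X, X.erase x ∈ J := by
    intro X hc hX hs
    exact h.base.full hc hX (by by_contra h₂; exact hs (h.sfx_sub X hc ⟨hX, h₂⟩))
  have hlow := low_sfxUnion h.sub_top h.cons h.base.top
  exact exists_cons_insert (cons_sfxUnion_top h.sub_top hTJ h.base h.cons) hlow.1 hlow.2
    hc₀ hX₀ hX₀'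

/-! ### Linear extensions and interchanges of neighbours. -/

/-- Interchange of two distinct neighbours which are not related by `R`. -/
def AdjSwap {α : Type*} (R : α → α → Prop) (l l' : List α) : Prop :=
  ∃ l₁ l₂ a b, l = l₁ ++ a :: b :: l₂ ∧ l' = l₁ ++ b :: a :: l₂ ∧ a ≠ b ∧ ¬ R a b ∧ ¬ R b a

theorem AdjSwap.perm {α : Type*} {R : α → α → Prop} {l l' : List α} (h : AdjSwap R l l') :
    l.Perm l' := by
  obtain ⟨l₁, l₂, a, b, rfl, rfl, -⟩ := h
  exact (List.Perm.swap b a l₂).append_left l₁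

theorem AdjSwap.pairwise {α : Type*} {R : α → α → Prop} {l l' : List α} (h : AdjSwap R l l')
    (hl : l.Pairwise (fun a b => ¬ R b a)) : l'.Pairwise (fun a b => ¬ R b a) := by
  obtain ⟨l₁, l₂, a, b, rfl, rfl, -, h₁, -⟩ := h
  simp only [List.pairwise_append, List.pairwise_cons, List.mem_cons] at hl ⊢
  grind

theorem AdjSwap.cons {α : Type*} {R : α → α → Prop} {l l' : List α} (c : α) (h : AdjSwap R l l') :
    AdjSwap R (c :: l) (c :: l') := by
  obtain ⟨l₁, l₂, a, b, rfl, rfl, h⟩ := h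
  exact ⟨c :: l₁, l₂, a, b, rfl, rfl, h⟩

theorem reflTransGen_adjSwap_bubble {α : Type*} {R : α → α → Prop} (a : α) (l₂ : List α) :
    ∀ l₁ : List α, (∀ b ∈ l₁, a ≠ b ∧ ¬ R a b ∧ ¬ R b a) →
      Relation.ReflTransGen (AdjSwap R) (a :: (l₁ ++ l₂)) (l₁ ++ a :: l₂)
  | [], _ => Relation.ReflTransGen.refl
  | b :: l₁, h => by
    have ih := reflTransGen_adjSwap_bubble a l₂ l₁ fun c hc => h c (List.mem_cons_of_mem _ hc)
    have h₁ : AdjSwap R (a :: ((b :: l₁) ++ l₂)) (b :: (a :: (l₁ ++ l₂))) :=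
      ⟨[], l₁ ++ l₂, a, b, rfl, rfl, h b (List.mem_cons_self ..)⟩
    exact Relation.ReflTransGen.head h₁ (ih.lift (b :: ·) fun _ _ => AdjSwap.cons b)

/-- Two linear extensions of the same relation are connected by interchanges of unrelated
neighbours. -/
theorem reflTransGen_adjSwap {α : Type*} {R : α → α → Prop} :
    ∀ l l' : List α, l.Nodup → l.Perm l' → l.Pairwise (fun a b => ¬ R b a) →
      l'.Pairwise (fun a b => ¬ R b a) → Relation.ReflTransGen (AdjSwap R) l l'
  | [], l', _, hp, _, _ => by
    rw [List.nil_perm.1 hp]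
  | a :: l, l', hn, hp, h, h' => by
    obtain ⟨l₁, l₂, rfl⟩ := List.append_of_mem (hp.subset (List.mem_cons_self ..))
    have hp' : l.Perm (l₁ ++ l₂) := (hp.trans List.perm_middle).cons_inv
    have hn' := hp.nodup_iff.1 hn
    rw [List.nodup_cons] at hn
    rw [List.pairwise_cons] at h
    have h'' : (l₁ ++ l₂).Pairwise (fun a b => ¬ R b a) :=
      h'.sublist ((List.sublist_cons_self a l₂).append_left l₁)
    have ih := reflTransGen_adjSwap l (l₁ ++ l₂) hn.2 hp' h.2 h''
    refine (ih.lift (a :: ·) fun _ _ => AdjSwap.cons a).trans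
      (reflTransGen_adjSwap_bubble a l₂ l₁ fun b hb => ?_)
    have hbl : b ∈ l := hp'.symm.subset (List.mem_append_left _ hb)
    refine ⟨?_, ?_, h.1 b hbl⟩
    · rintro rfl; exact hn.1 hbl
    · exact (List.pairwise_append.1 h').2.2 b hb a (List.mem_cons_self ..)

/-! ### Linear extensions of `Step` as orders on packets. -/

/-- `ρ` is a linear extension of `Step m U`. -/
def Ext (m : ℕ) (U : Set (Finset (Fin n))) (ρ : List (Finset (Fin n))) : Prop :=
  ρ.Pairwise (fun A B => ¬ Step m U B A)

theorem exists_ext {m : ℕ} {U : Set (Finset (Fin n))} (hU : Cons Finset.univ m U)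
    (S : Finset (Finset (Fin n))) : ∃ ρ : List (Finset (Fin n)), ρ.Nodup ∧ ρ.toFinset = S ∧ Ext m U ρ := by
  obtain ⟨f, hf⟩ := hU.exists_rank
  let r : Finset (Fin n) → Finset (Fin n) → Prop := fun A B => f A ≤ f B
  have : Std.Total r := ⟨fun A B => le_total (f A) (f B)⟩
  have : IsTrans _ r := ⟨fun A B C => le_trans⟩
  classical
  have hp := List.perm_insertionSort r S.toList
  refine ⟨S.toList.insertionSort r, hp.nodup_iff.2 S.nodup_toList, ?_, ?_⟩
  · rw [List.toFinset_eq_of_perm _ _ hp, Finset.toList_toFinset]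
  · exact (List.pairwise_insertionSort r S.toList).imp fun {A B} h hs => absurd (hf _ _ hs) (not_lt.2 h)

theorem Step.ne {m : ℕ} {U : Set (Finset (Fin n))} {A B : Finset (Fin n)} (h : Step m U A B) :
    A ≠ B := by
  obtain ⟨X, x, y, hc, hx, hy, rfl, rfl, h₁, h₂⟩ := h
  intro he
  have hxy : x = y := by
    by_contra hne
    have : x ∈ X.erase y := Finset.mem_erase.2 ⟨hne, hx⟩
    rw [← he] at this
    exact Finset.notMem_erase _ _ this
  subst hxy
  by_cases h : X ∈ U
  · exact lt_irrefl _ (h₁ h)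
  · exact lt_irrefl _ (h₂ h)

theorem step_or_step {m : ℕ} {U : Set (Finset (Fin n))} {X : Finset (Fin n)} (hX : X.card = m)
    {x y : Fin n} (hx : x ∈ X) (hy : y ∈ X) (hxy : x < y) :
    (X ∈ U → Step m U (X.erase x) (X.erase y)) ∧ (X ∉ U → Step m U (X.erase y) (X.erase x)) :=
  ⟨fun h => ⟨X, x, y, hX, hx, hy, rfl, rfl, fun _ => hxy, fun h' => absurd h h'⟩,
    fun h => ⟨X, y, x, hX, hy, hx, rfl, rfl, fun h' => absurd h' h, fun _ => hxy⟩⟩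

theorem mem_packet_iff {k : ℕ} {X A : Finset (Fin n)} (hX : X.card = k + 1) :
    A ∈ packet k X ↔ ∃ x ∈ X, A = X.erase x := by
  rw [packet, Finset.mem_powersetCard]
  constructor
  · rintro ⟨hs, hc⟩
    have : (X \ A).card = 1 := by rw [Finset.card_sdiff_of_subset hs]; omega
    obtain ⟨x, hx⟩ := Finset.card_eq_one.1 this
    have hx' : x ∈ X \ A := by rw [hx]; exact Finset.mem_singleton_self x
    refine ⟨x, (Finset.mem_sdiff.1 hx').1, ?_⟩
    rw [Finset.erase_eq, ← hx, Finset.sdiff_sdiff_eq_self hs]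
  · rintro ⟨x, hx, rfl⟩
    exact ⟨Finset.erase_subset _ _, by rw [Finset.card_erase_of_mem hx, hX]; rfl⟩

theorem mem_C {k : ℕ} {A : Finset (Fin n)} : A ∈ C n k ↔ A.card = k := by
  simp [C]

theorem erase_mem_packet {k : ℕ} {X : Finset (Fin n)} (hX : X.card = k + 1) {x : Fin n}
    (hx : x ∈ X) : X.erase x ∈ packet k X := (mem_packet_iff hX).2 ⟨x, hx, rfl⟩

/-- Any two distinct members of a packet are comparable under `Step`, so the swaps of `AdjSwap` are
elementary swaps. -/
theorem not_sharePacket {k : ℕ} {U : Set (Finset (Fin n))} {A B : Finset (Fin n)} (hne : A ≠ B)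
    (h₁ : ¬ Step (k + 1) U A B) (h₂ : ¬ Step (k + 1) U B A) : ¬ SharePacket k A B := by
  rintro ⟨X, hX, hA, hB⟩
  rw [mem_C] at hX
  obtain ⟨x, hx, rfl⟩ := (mem_packet_iff hX).1 hA
  obtain ⟨y, hy, rfl⟩ := (mem_packet_iff hX).1 hB
  have hxy : x ≠ y := by rintro rfl; exact hne rfl
  by_cases hU : X ∈ U
  · rcases hxy.lt_or_gt with h | h
    · exact h₁ ((step_or_step hX hx hy h).1 hU)
    · exact h₂ ((step_or_step hX hy hx h).1 hU)
  · rcases hxy.lt_or_gt with h | h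
    · exact h₂ ((step_or_step hX hx hy h).2 hU)
    · exact h₁ ((step_or_step hX hy hx h).2 hU)

theorem AdjSwap.isElementarySwap {k : ℕ} {U : Set (Finset (Fin n))} {l l' : List (Finset (Fin n))}
    (h : AdjSwap (Step (k + 1) U) l l') : IsElementarySwap k l l' := by
  obtain ⟨l₁, l₂, a, b, e₁, e₂, h₁, h₂, h₃⟩ := h
  exact ⟨l₁, l₂, a, b, e₁, e₂, not_sharePacket h₁ h₂ h₃⟩

theorem lexLT_erase {X : Finset (Fin n)} {x y : Fin n} (hx : x ∈ X) (hy : y ∈ X) :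
    LexLT (X.erase x) (X.erase y) ↔ y < x := by
  constructor
  · rintro ⟨a, ha, hb, h⟩
    have hay : a = y := by
      by_contra hne
      exact hb (Finset.mem_erase.2 ⟨hne, Finset.mem_of_mem_erase ha⟩)
    subst hay
    by_contra hlt
    have hne : a ≠ x := Finset.ne_of_mem_erase ha
    have hxa : x < a := lt_of_le_of_ne (not_lt.1 hlt) hne.symm
    exact Finset.notMem_erase x X ((h x hxa).2 (Finset.mem_erase.2 ⟨hne.symm, hx⟩))
  · intro h
    refine ⟨y, Finset.mem_erase.2 ⟨h.ne, hy⟩, Finset.notMem_erase _ _, fun b hb => ?_⟩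
    simp [hb.ne, (hb.trans h).ne]

theorem Ext.induces {k : ℕ} {U : Set (Finset (Fin n))} {ρ : List (Finset (Fin n))}
    (hn : ρ.Nodup) (h : Ext (k + 1) U ρ) {X : Finset (Fin n)} (hX : X.card = k + 1) :
    (X ∈ U → InducesAntilex ρ (packet k X)) ∧ (X ∉ U → InducesLex ρ (packet k X)) := by
  have h' := List.pairwise_and_iff.2 ⟨h, hn⟩
  constructor
  · intro hU
    rw [InducesAntilex, List.pairwise_filter]
    refine h'.imp fun {A B} hAB hA hB => ?_
    obtain ⟨x, hx, rfl⟩ := (mem_packet_iff hX).1 (of_decide_eq_true hA)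
    obtain ⟨y, hy, rfl⟩ := (mem_packet_iff hX).1 (of_decide_eq_true hB)
    have hxy : x ≠ y := by rintro rfl; exact hAB.2 rfl
    rw [lexLT_erase hy hx]
    by_contra hlt
    exact hAB.1 ((step_or_step hX hy hx (lt_of_le_of_ne (not_lt.1 hlt) hxy.symm)).1 hU)
  · intro hU
    rw [InducesLex, List.pairwise_filter]
    refine h'.imp fun {A B} hAB hA hB => ?_
    obtain ⟨x, hx, rfl⟩ := (mem_packet_iff hX).1 (of_decide_eq_true hA)
    obtain ⟨y, hy, rfl⟩ := (mem_packet_iff hX).1 (of_decide_eq_true hB)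
    have hxy : x ≠ y := by rintro rfl; exact hAB.2 rfl
    rw [lexLT_erase hx hy]
    by_contra hlt
    exact hAB.1 ((step_or_step hX hx hy (lt_of_le_of_ne (not_lt.1 hlt) hxy)).2 hU)

theorem ext_of_induces {k : ℕ} {U : Set (Finset (Fin n))} {ρ : List (Finset (Fin n))}
    (h : ∀ X : Finset (Fin n), X.card = k + 1 →
      (X ∈ U → InducesAntilex ρ (packet k X)) ∧ (X ∉ U → InducesLex ρ (packet k X))) :
    Ext (k + 1) U ρ := by
  rw [Ext, List.pairwise_iff_forall_sublist]
  rintro A B hs ⟨X, x, y, hX, hx, hy, rfl, rfl, h₁, h₂⟩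
  by_cases hU : X ∈ U
  · have := (h X hX).1 hU
    rw [InducesAntilex, List.pairwise_filter, List.pairwise_iff_forall_sublist] at this
    have := this hs (decide_eq_true (erase_mem_packet hX hy)) (decide_eq_true (erase_mem_packet hX hx))
    rw [lexLT_erase hx hy] at this
    exact lt_asymm this (h₁ hU)
  · have := (h X hX).2 hU
    rw [InducesLex, List.pairwise_filter, List.pairwise_iff_forall_sublist] at this
    have := this hs (decide_eq_true (erase_mem_packet hX hy)) (decide_eq_true (erase_mem_packet hX hx))
    rw [lexLT_erase hy hx] at this
    exact lt_asymm this (h₂ hU)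

theorem sublist_pair_or {α : Type*} {ρ : List α} {a b : α} (hab : a ≠ b) (ha : a ∈ ρ) (hb : b ∈ ρ) :
    [a, b].Sublist ρ ∨ [b, a].Sublist ρ := by
  obtain ⟨l₁, l₂, rfl⟩ := List.append_of_mem ha
  rcases List.mem_append.1 hb with h | h
  · right
    exact (List.singleton_sublist.2 h).append (List.singleton_sublist.2 (List.mem_cons_self ..))
  · left
    have h := (List.mem_cons.1 h).resolve_left hab.symm
    exact ((List.singleton_sublist.2 h).cons_cons a).trans (List.sublist_append_right ..)

/-- With `0 < k` the packet has at least two members, so the two orders exclude each other. This is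
what lets `U` be read off from a linear extension. -/
theorem not_induces_both {k : ℕ} (hk : 0 < k) {ρ : List (Finset (Fin n))} {X : Finset (Fin n)}
    (hX : X.card = k + 1) (hρ : packet k X ⊆ ρ.toFinset) (h₁ : InducesLex ρ (packet k X))
    (h₂ : InducesAntilex ρ (packet k X)) : False := by
  obtain ⟨x, hx, y, hy, hxy⟩ := Finset.one_lt_card.1 (by omega : 1 < X.card)
  have mx := List.mem_toFinset.1 (hρ (erase_mem_packet hX hx))
  have my := List.mem_toFinset.1 (hρ (erase_mem_packet hX hy))
  have hne : X.erase x ≠ X.erase y := by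
    intro he
    have : x ∈ X.erase y := Finset.mem_erase.2 ⟨hxy, hx⟩
    rw [← he] at this
    exact Finset.notMem_erase _ _ this
  rw [InducesAntilex, List.pairwise_filter, List.pairwise_iff_forall_sublist] at h₂
  rw [InducesLex, List.pairwise_filter, List.pairwise_iff_forall_sublist] at h₁
  have dx := decide_eq_true (erase_mem_packet hX hx)
  have dy := decide_eq_true (erase_mem_packet hX hy)
  rcases sublist_pair_or hne mx my with h | h
  · have e₁ := h₁ h dx dy
    have e₂ := h₂ h dx dy
    rw [lexLT_erase hx hy] at e₁
    rw [lexLT_erase hy hx] at e₂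
    exact lt_asymm e₁ e₂
  · have e₁ := h₁ h dy dx
    have e₂ := h₂ h dy dx
    rw [lexLT_erase hy hx] at e₁
    rw [lexLT_erase hx hy] at e₂
    exact lt_asymm e₁ e₂

theorem Ext.induces_antilex_iff {k : ℕ} (hk : 0 < k) {U : Set (Finset (Fin n))}
    {ρ : List (Finset (Fin n))} (hn : ρ.Nodup) (h : Ext (k + 1) U ρ) {X : Finset (Fin n)}
    (hX : X.card = k + 1) (hρ : packet k X ⊆ ρ.toFinset) :
    InducesAntilex ρ (packet k X) ↔ X ∈ U := by
  refine ⟨fun ha => ?_, (h.induces hn hX).1⟩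
  by_contra hU
  exact not_induces_both hk hX hρ ((h.induces hn hX).2 hU) ha

/-- A linear extension listing all sets forces consistency. -/
theorem Ext.cons {k : ℕ} {U : Set (Finset (Fin n))} {ρ : List (Finset (Fin n))}
    (h : Ext (k + 1) U ρ) (hρ : ∀ A : Finset (Fin n), A.card = k → A ∈ ρ) :
    Cons Finset.univ (k + 1) U := by
  refine cons_of_rank (fun A => ρ.idxOf A) fun A B hA hB hs => ?_
  have hA' := List.idxOf_lt_length_iff.2 (hρ A (by omega))
  have hB' := List.idxOf_lt_length_iff.2 (hρ B (by omega))
  by_contra hlt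
  rcases (not_lt.1 hlt).eq_or_lt with he | hlt
  · exact hs.ne ((List.idxOf_inj (hρ B (by omega))).1 he).symm
  · have := List.pairwise_iff_getElem.1 h _ _ hB' hA' hlt
    rw [List.getElem_idxOf, List.getElem_idxOf] at this
    exact this hs

theorem Low.of_prefix {m : ℕ} {U : Set (Finset (Fin n))} {l₁ l₂ : List (Finset (Fin n))}
    (h : Ext m U (l₁ ++ l₂)) (hl : Low m U {A | A ∈ l₁ ++ l₂}) : Low m U {A | A ∈ l₁} := by
  intro A B hs hB
  have hA : A ∈ l₁ ++ l₂ := hl A B hs (List.mem_append_left _ hB)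
  rcases List.mem_append.1 hA with hA | hA
  · exact hA
  · exact absurd hs ((List.pairwise_append.1 h).2.2 B hB A hA)

/-! ### Making a packet contiguous and reversing it. -/

/-- Two distinct members of a packet determine the set `X`, of which they are two facets. -/
theorem Step.of_packet {k : ℕ} {U : Set (Finset (Fin n))} {X A B : Finset (Fin n)}
    (hX : X.card = k + 1) (h : Step (k + 1) U A B) (hA : A ∈ packet k X) (hB : B ∈ packet k X) :
    ∃ x y, x ∈ X ∧ y ∈ X ∧ A = X.erase x ∧ B = X.erase y ∧ (X ∈ U → x < y) ∧ (X ∉ U → y < x) := by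
  have hne := h.ne
  obtain ⟨Y, x, y, hY, hx, hy, rfl, rfl, h₁, h₂⟩ := h
  have hYX : Y = X := by
    refine Finset.eq_of_subset_of_card_le (fun z hz => ?_) (by omega)
    have hs₁ := (Finset.mem_powersetCard.1 hA).1
    have hs₂ := (Finset.mem_powersetCard.1 hB).1
    by_cases hzx : z = x
    · refine hs₂ (Finset.mem_erase.2 ⟨?_, hz⟩)
      rintro rfl
      exact hne (by rw [hzx])
    · exact hs₁ (Finset.mem_erase.2 ⟨hzx, hz⟩)
  subst hYX
  exact ⟨x, y, hx, hy, rfl, rfl, h₁, h₂⟩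

theorem Step.congr_of_not_packet {k : ℕ} {U U' : Set (Finset (Fin n))} {X A B : Finset (Fin n)}
    (h₁ : ∀ Y, Y ≠ X → (Y ∈ U' ↔ Y ∈ U)) (hAB : ¬ (A ∈ packet k X ∧ B ∈ packet k X))
    (h : Step (k + 1) U A B) : Step (k + 1) U' A B := by
  obtain ⟨Y, x, y, hY, hx, hy, rfl, rfl, hs⟩ := h
  have hne : Y ≠ X := by
    rintro rfl
    exact hAB ⟨erase_mem_packet hY hx, erase_mem_packet hY hy⟩
  exact ⟨Y, x, y, hY, hx, hy, rfl, rfl, by rwa [h₁ Y hne]⟩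

theorem Step.symm_of_packet {k : ℕ} {U U' : Set (Finset (Fin n))} {X A B : Finset (Fin n)}
    (hX : X.card = k + 1) (h₂ : X ∈ U' ↔ X ∉ U) (hA : A ∈ packet k X) (hB : B ∈ packet k X)
    (h : Step (k + 1) U A B) : Step (k + 1) U' B A := by
  obtain ⟨x, y, hx, hy, rfl, rfl, hs₁, hs₂⟩ := h.of_packet hX hA hB
  exact ⟨X, y, x, hX, hy, hx, rfl, rfl, fun h => hs₂ (h₂.1 h), fun h => hs₁ (by tauto)⟩

/-- Reversing a contiguous packet changes the family at exactly one place. -/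
theorem Ext.reverse_packet {k : ℕ} {U U' : Set (Finset (Fin n))} {X : Finset (Fin n)}
    (hX : X.card = k + 1) (h₁ : ∀ Y, Y ≠ X → (Y ∈ U' ↔ Y ∈ U)) (h₂ : X ∈ U' ↔ X ∉ U)
    {l₁ c l₂ : List (Finset (Fin n))} (hn : (l₁ ++ c ++ l₂).Nodup) (hc : c.toFinset = packet k X)
    (h : Ext (k + 1) U (l₁ ++ c ++ l₂)) : Ext (k + 1) U' (l₁ ++ c.reverse ++ l₂) := by
  have h₂' : X ∈ U ↔ X ∉ U' := by tauto
  have hmem : ∀ A, A ∈ c ↔ A ∈ packet k X := fun A => by rw [← hc, List.mem_toFinset]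
  rw [List.nodup_append, List.nodup_append] at hn
  obtain ⟨⟨-, -, hd₁⟩, -, hd₂⟩ := hn
  have n₁ : ∀ A ∈ l₁, A ∉ packet k X := fun A hA hP => hd₁ A hA A ((hmem A).2 hP) rfl
  have n₂ : ∀ A ∈ l₂, A ∉ packet k X := fun A hA hP =>
    hd₂ A (List.mem_append_right _ ((hmem A).2 hP)) A hA rfl
  have cg : ∀ A B, ¬ (A ∈ packet k X ∧ B ∈ packet k X) → ¬ Step (k + 1) U A B →
      ¬ Step (k + 1) U' A B := fun A B hAB hs hs' =>
    hs (hs'.congr_of_not_packet (fun Y hY => (h₁ Y hY).symm) hAB)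
  unfold Ext at h ⊢
  rw [List.pairwise_append, List.pairwise_append] at h ⊢
  obtain ⟨⟨e₁, e₂, e₃⟩, e₄, e₅⟩ := h
  refine ⟨⟨?_, ?_, ?_⟩, ?_, ?_⟩
  · exact e₁.imp_of_mem fun {A B} hA hB hs => cg _ _ (fun h => n₁ A hA h.2) hs
  · rw [List.pairwise_reverse]
    exact e₂.imp_of_mem fun {A B} hA hB hs hs' =>
      hs (hs'.symm_of_packet hX h₂' ((hmem A).1 hA) ((hmem B).1 hB))
  · intro A hA B hB
    exact cg _ _ (fun h => n₁ A hA h.2) (e₃ A hA B (List.mem_reverse.1 hB))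
  · exact e₄.imp_of_mem fun {A B} hA hB hs => cg _ _ (fun h => n₂ A hA h.2) hs
  · intro A hA B hB
    refine cg _ _ (fun h => n₂ B hB h.1) (e₅ A ?_ B hB)
    simpa using hA

/-- If changing `U` at `X` preserves acyclicity, the packet of `X` can be made contiguous. -/
theorem Ext.exists_block {k : ℕ} {U U' : Set (Finset (Fin n))} {X : Finset (Fin n)}
    (hX : X.card = k + 1) (h₁ : ∀ Y, Y ≠ X → (Y ∈ U' ↔ Y ∈ U)) (h₂ : X ∈ U' ↔ X ∉ U)
    (hU : Cons Finset.univ (k + 1) U) (hU' : Cons Finset.univ (k + 1) U')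
    {ρ : List (Finset (Fin n))} (hn : ρ.Nodup) (h : Ext (k + 1) U ρ)
    (hρ : packet k X ⊆ ρ.toFinset) :
    ∃ l₁ c l₂ : List (Finset (Fin n)), ρ.Perm (l₁ ++ c ++ l₂) ∧ c.toFinset = packet k X ∧
      Ext (k + 1) U (l₁ ++ c ++ l₂) ∧ Ext (k + 1) U' (l₁ ++ c.reverse ++ l₂) := by
  classical
  obtain ⟨f, hf⟩ := hU.exists_rank
  obtain ⟨f', hf'⟩ := hU'.exists_rank
  -- `Q` is the part of the relation common to `U` and `U'`. A `Q`-chain raises both ranks, while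
  -- any two members of the packet of `X` are ordered oppositely by `U` and `U'`; so no `Q`-chain
  -- joins members of the packet.
  let Q : Finset (Fin n) → Finset (Fin n) → Prop := fun A B =>
    Step (k + 1) U A B ∧ ¬ (A ∈ packet k X ∧ B ∈ packet k X)
  have hQ : ∀ A B, Relation.TransGen Q A B → f A < f B ∧ f' A < f' B := by
    intro A B hAB
    induction hAB with
    | single h => exact ⟨hf _ _ h.1, hf' _ _ (h.1.congr_of_not_packet h₁ h.2)⟩
    | tail _ h ih =>
      exact ⟨ih.1.trans (hf _ _ h.1), ih.2.trans (hf' _ _ (h.1.congr_of_not_packet h₁ h.2))⟩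
  have hP : ∀ A ∈ packet k X, ∀ B ∈ packet k X, ¬ Relation.TransGen Q A B := by
    intro A hA B hB hAB
    obtain ⟨g, g'⟩ := hQ A B hAB
    obtain ⟨x, hx, rfl⟩ := (mem_packet_iff hX).1 hA
    obtain ⟨y, hy, rfl⟩ := (mem_packet_iff hX).1 hB
    have hxy : x ≠ y := by rintro rfl; exact lt_irrefl _ g
    have key : Step (k + 1) U (X.erase y) (X.erase x) ∨ Step (k + 1) U' (X.erase y) (X.erase x) := by
      by_cases hXU : X ∈ U
      · have hXU' : X ∉ U' := fun h => h₂.1 h hXU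
        rcases hxy.lt_or_gt with h | h
        · exact Or.inr ((step_or_step hX hx hy h).2 hXU')
        · exact Or.inl ((step_or_step hX hy hx h).1 hXU)
      · have hXU' : X ∈ U' := h₂.2 hXU
        rcases hxy.lt_or_gt with h | h
        · exact Or.inl ((step_or_step hX hx hy h).2 hXU)
        · exact Or.inr ((step_or_step hX hy hx h).1 hXU')
    rcases key with h | h
    · exact lt_asymm g (hf _ _ h)
    · exact lt_asymm g' (hf' _ _ h)
  -- New order: first the sets outside the packet that have a `Q`-chain into it, then the packet,
  -- then the rest, each part keeping the order of `ρ`.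
  let L : Finset (Fin n) → Prop := fun Z => Z ∉ packet k X ∧ ∃ A ∈ packet k X, Relation.TransGen Q Z A
  let M : Finset (Fin n) → Prop := fun Z => Z ∈ packet k X
  have hperm : ρ.Perm (ρ.filter L ++ (ρ.filter fun Z => ¬ L Z).filter M ++
      (ρ.filter fun Z => ¬ L Z).filter fun Z => ¬ M Z) := by
    have p₁ := List.filter_append_perm (fun Z => decide (L Z)) ρ
    have p₂ := List.filter_append_perm (fun Z => decide (M Z)) (ρ.filter fun Z => ¬ L Z)
    rw [List.append_assoc]
    simp only [← decide_not] at p₁ p₂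
    exact p₁.symm.trans (p₂.symm.append_left _)
  have hcmem : ∀ A, A ∈ (ρ.filter fun Z => ¬ L Z).filter M ↔ A ∈ packet k X := by
    intro A
    simp only [List.mem_filter, decide_eq_true_eq]
    refine ⟨fun h => h.2, fun h => ⟨⟨List.mem_toFinset.1 (hρ h), fun hL => hL.1 h⟩, h⟩⟩
  have hc : ((ρ.filter fun Z => ¬ L Z).filter M).toFinset = packet k X := by
    ext A
    rw [List.mem_toFinset, hcmem]
  have hE : Ext (k + 1) U (ρ.filter L ++ (ρ.filter fun Z => ¬ L Z).filter M ++
      (ρ.filter fun Z => ¬ L Z).filter fun Z => ¬ M Z) := by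
    unfold Ext at h ⊢
    rw [List.pairwise_append, List.pairwise_append]
    refine ⟨⟨h.filter _, (h.filter _).filter _, ?_⟩, (h.filter _).filter _, ?_⟩
    · intro Z hZ A hA hs
      have hZL : L Z := by simpa using (List.mem_filter.1 hZ).2
      rw [hcmem] at hA
      obtain ⟨hZ₁, B, hB, hZB⟩ := hZL
      exact hP A hA B hB (Relation.TransGen.head ⟨hs, fun h => hZ₁ h.2⟩ hZB)
    · intro Z hZ A hA hs
      simp only [List.mem_filter, decide_eq_true_eq] at hA
      obtain ⟨⟨-, hAL⟩, hAM⟩ := hA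
      rcases List.mem_append.1 hZ with hZ | hZ
      · have hZL : L Z := by simpa using (List.mem_filter.1 hZ).2
        obtain ⟨hZ₁, B, hB, hZB⟩ := hZL
        exact hAL ⟨hAM, B, hB, Relation.TransGen.head ⟨hs, fun h => hZ₁ h.2⟩ hZB⟩
      · rw [hcmem] at hZ
        exact hAL ⟨hAM, Z, hZ, Relation.TransGen.single ⟨hs, fun h => hAM h.1⟩⟩
  exact ⟨_, _, _, hperm, hc, hE, Ext.reverse_packet hX h₁ h₂ (hperm.nodup_iff.1 hn) hc hE⟩

/-! ### Realizability as consistency. -/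

/-- Erasing a larger element gives a lexicographically smaller set, so an initial segment
corresponds to a pattern monotone in the erased element. -/
theorem isPrefix_iff {k : ℕ} {J : Finset (Finset (Fin n))} {X : Finset (Fin n)}
    (hX : X.card = k + 1) : IsPrefix (packet k X ∩ J) (packet k X) ↔
      MonotoneOn (fun x => X.erase x ∈ (J : Set (Finset (Fin n)))) X := by
  constructor
  · rintro ⟨-, h⟩ x hx y hy hxy hJ
    rcases hxy.eq_or_lt with rfl | hxy
    · exact hJ
    · exact (Finset.mem_inter.1 (h _ (Finset.mem_inter.2 ⟨erase_mem_packet hX hx, hJ⟩) _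
        (erase_mem_packet hX hy) ((lexLT_erase hy hx).2 hxy))).2
  · refine fun h => ⟨Finset.inter_subset_left, fun A hA D hD hl => ?_⟩
    obtain ⟨hA, hAJ⟩ := Finset.mem_inter.1 hA
    obtain ⟨x, hx, rfl⟩ := (mem_packet_iff hX).1 hA
    obtain ⟨y, hy, rfl⟩ := (mem_packet_iff hX).1 hD
    exact Finset.mem_inter.2 ⟨hD, h hx hy ((lexLT_erase hy hx).1 hl).le hAJ⟩

theorem isSuffix_iff {k : ℕ} {J : Finset (Finset (Fin n))} {X : Finset (Fin n)}
    (hX : X.card = k + 1) : IsSuffix (packet k X ∩ J) (packet k X) ↔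
      AntitoneOn (fun x => X.erase x ∈ (J : Set (Finset (Fin n)))) X := by
  constructor
  · rintro ⟨-, h⟩ y hy x hx hxy hJ
    rcases hxy.eq_or_lt with rfl | hxy
    · exact hJ
    · exact (Finset.mem_inter.1 (h _ (Finset.mem_inter.2 ⟨erase_mem_packet hX hx, hJ⟩) _
        (erase_mem_packet hX hy) ((lexLT_erase hx hy).2 hxy))).2
  · refine fun h => ⟨Finset.inter_subset_left, fun A hA D hD hl => ?_⟩
    obtain ⟨hA, hAJ⟩ := Finset.mem_inter.1 hA
    obtain ⟨x, hx, rfl⟩ := (mem_packet_iff hX).1 hA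
    obtain ⟨y, hy, rfl⟩ := (mem_packet_iff hX).1 hD
    exact Finset.mem_inter.2 ⟨hD, h hy hx ((lexLT_erase hx hy).1 hl).le hAJ⟩

theorem realizable_iff {k : ℕ} {J : Finset (Finset (Fin n))} :
    Realizable k J ↔ J ⊆ C n k ∧ Cons Finset.univ k (J : Set (Finset (Fin n))) := by
  refine and_congr_right fun _ => ⟨fun h X _ hX => ?_, fun h X hX => ?_⟩
  · exact (h X (mem_C.2 hX)).imp (isPrefix_iff hX).1 (isSuffix_iff hX).1
  · rw [mem_C] at hX
    exact (h X (Finset.subset_univ _) hX).imp (isPrefix_iff hX).2 (isSuffix_iff hX).2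

theorem packet_subset_C {k : ℕ} {X : Finset (Fin n)} : packet k X ⊆ C n k := fun _ hA =>
  mem_C.2 (Finset.mem_powersetCard.1 hA).2

/-! ### `B(n,j)` through inversion sets. -/

theorem AdmissibleOrder.ext_inv {j : ℕ} (ρ : AdmissibleOrder n j) :
    Ext (j + 1) (ρ.Inv : Set (Finset (Fin n))) ρ.1 := by
  refine ext_of_induces fun X hX => ⟨fun h => (Finset.mem_filter.1 h).2, fun h => ?_⟩
  refine (ρ.2.2 X (mem_C.2 hX)).resolve_right fun ha => h ?_
  exact Finset.mem_coe.2 (Finset.mem_filter.2 ⟨mem_C.2 hX, ha⟩)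

theorem AdmissibleOrder.mem_iff {j : ℕ} (ρ : AdmissibleOrder n j) {A : Finset (Fin n)} :
    A ∈ ρ.1 ↔ A.card = j := by
  rw [← List.mem_toFinset, ρ.2.1.2, mem_C]

theorem AdmissibleOrder.packet_subset {j : ℕ} (ρ : AdmissibleOrder n j) {X : Finset (Fin n)} :
    packet j X ⊆ ρ.1.toFinset := by
  rw [ρ.2.1.2]
  exact packet_subset_C

theorem AdmissibleOrder.inv_eq {j : ℕ} (hj : 0 < j) (ρ : AdmissibleOrder n j)
    {U : Finset (Finset (Fin n))} (hU : U ⊆ C n (j + 1)) (h : Ext (j + 1) U ρ.1) : ρ.Inv = U := by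
  ext X
  by_cases hX : X.card = j + 1
  · rw [AdmissibleOrder.Inv, Finset.mem_filter,
      h.induces_antilex_iff hj ρ.2.1.1 hX ρ.packet_subset]
    exact ⟨fun h => h.2, fun h => ⟨mem_C.2 hX, h⟩⟩
  · refine ⟨fun h => absurd (mem_C.1 (Finset.mem_filter.1 h).1) hX, fun h => absurd (mem_C.1 (hU h)) hX⟩

theorem exists_admissible {j : ℕ} {U : Set (Finset (Fin n))} {l : List (Finset (Fin n))}
    (hl : IsOrderOn l (C n j)) (h : Ext (j + 1) U l) : ∃ ρ : AdmissibleOrder n j, ρ.1 = l := by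
  refine ⟨⟨l, hl, fun X hX => ?_⟩, rfl⟩
  have hi := h.induces hl.1 (mem_C.1 hX)
  by_cases hU : X ∈ U
  · exact Or.inr (hi.1 hU)
  · exact Or.inl (hi.2 hU)

/-- Linear extensions of one relation are connected by interchanges, and each intermediate list is
again admissible, so the whole chain stays in one class. -/
theorem B.mk_eq {j : ℕ} {U : Set (Finset (Fin n))} (ρ ρ' : AdmissibleOrder n j)
    (h : Ext (j + 1) U ρ.1) (h' : Ext (j + 1) U ρ'.1) : B.mk ρ = B.mk ρ' := by
  have hp : ρ.1.Perm ρ'.1 := List.perm_of_nodup_nodup_toFinset_eq ρ.2.1.1 ρ'.2.1.1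
    (ρ.2.1.2.trans ρ'.2.1.2.symm)
  have key : ∀ l, Relation.ReflTransGen (AdjSwap (Step (j + 1) U)) ρ.1 l →
      Ext (j + 1) U l ∧ ∀ σ : AdmissibleOrder n j, σ.1 = l → B.mk ρ = B.mk σ := by
    intro l hl
    induction hl with
    | refl => exact ⟨h, fun σ hσ => by rw [Subtype.ext hσ]⟩
    | tail _ hs ih =>
      refine ⟨hs.pairwise ih.1, fun σ hσ => ?_⟩
      obtain ⟨τ, hτ⟩ := exists_admissible (U := U) (j := j) (l := _)
        ⟨hs.perm.nodup_iff.2 (hσ ▸ σ.2.1.1), by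
          rw [List.toFinset_eq_of_perm _ _ hs.perm, ← hσ, σ.2.1.2]⟩ ih.1
      rw [ih.2 τ hτ]
      exact Quot.sound (by rw [hτ, hσ]; exact hs.isElementarySwap)
  exact (key _ (reflTransGen_adjSwap _ _ ρ.2.1.1 hp h h')).2 ρ' rfl

theorem B.exists_rep {j : ℕ} (r : B n j) : ∃ ρ, B.mk ρ = r := Quot.exists_rep r

theorem B.inv_mk {j : ℕ} (ρ : AdmissibleOrder n j) : (B.mk ρ).Inv = ρ.Inv := rfl

theorem B.eq_of_inv_eq {j : ℕ} {r r' : B n j} (h : r.Inv = r'.Inv) : r = r' := by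
  obtain ⟨ρ, rfl⟩ := r.exists_rep
  obtain ⟨ρ', rfl⟩ := r'.exists_rep
  refine B.mk_eq ρ ρ' ρ.ext_inv ?_
  rw [B.inv_mk, B.inv_mk] at h
  rw [h]
  exact ρ'.ext_inv

theorem B.inv_subset {j : ℕ} (r : B n j) : r.Inv ⊆ C n (j + 1) := by
  obtain ⟨ρ, rfl⟩ := r.exists_rep
  exact Finset.filter_subset _ _

theorem B.cons_inv {j : ℕ} (r : B n j) : Cons Finset.univ (j + 1) (r.Inv : Set (Finset (Fin n))) := by
  obtain ⟨ρ, rfl⟩ := r.exists_rep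
  exact ρ.ext_inv.cons fun A hA => ρ.mem_iff.2 hA

theorem B.FlipUp.inv_eq {j : ℕ} (hj : 0 < j) {X : Finset (Fin n)} {r r' : B n j}
    (h : B.FlipUp X r r') : r'.Inv = insert X r.Inv := by
  obtain ⟨hX, hXr, ρ, ρ', rfl, rfl, l₁, c, l₂, hc, e, e'⟩ := h
  rw [B.inv_mk] at hXr ⊢
  refine ρ'.inv_eq hj (Finset.insert_subset hX (B.inv_subset (B.mk ρ))) ?_
  rw [e']
  refine Ext.reverse_packet (U := (ρ.Inv : Set (Finset (Fin n)))) (mem_C.1 hX) ?_ ?_ (e ▸ ρ.2.1.1) hc (e ▸ ρ.ext_inv)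
  · intro Y hY
    rw [Finset.mem_coe, Finset.mem_insert]
    exact or_iff_right hY
  · simpa using hXr

/-- Consistency is the only obstruction to a flip: by `Ext.exists_block` it yields a representative
in which the packet is contiguous. -/
theorem B.exists_flipUp {j : ℕ} {X : Finset (Fin n)} {r : B n j} (hX : X ∈ C n (j + 1))
    (hXr : X ∉ r.Inv) (hc : Cons Finset.univ (j + 1) (insert X (r.Inv : Set (Finset (Fin n))))) :
    ∃ r', B.FlipUp X r r' := by
  have hr := r.cons_inv
  obtain ⟨ρ, rfl⟩ := r.exists_rep
  rw [B.inv_mk] at hXr hc hr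
  obtain ⟨l₁, c, l₂, hp, hcX, h₁, h₂⟩ := Ext.exists_block (mem_C.1 hX)
    (U' := insert X (ρ.Inv : Set (Finset (Fin n)))) (fun Y hY => by simp [hY]) (by simpa using hXr)
    hr hc ρ.2.1.1 ρ.ext_inv ρ.packet_subset
  have hp' : ρ.1.Perm (l₁ ++ c.reverse ++ l₂) := hp.trans
    (((List.reverse_perm c).symm.append_left l₁).append_right l₂)
  obtain ⟨σ, hσ⟩ := exists_admissible (j := j)
    ⟨hp.nodup_iff.1 ρ.2.1.1, by rw [← List.toFinset_eq_of_perm _ _ hp, ρ.2.1.2]⟩ h₁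
  obtain ⟨τ, hτ⟩ := exists_admissible (j := j)
    ⟨hp'.nodup_iff.1 ρ.2.1.1, by rw [← List.toFinset_eq_of_perm _ _ hp', ρ.2.1.2]⟩ h₂
  exact ⟨B.mk τ, hX, hXr, σ, τ, B.mk_eq σ ρ (hσ ▸ h₁) ρ.ext_inv, rfl, l₁, c, l₂, hcX, hσ, hτ⟩

theorem B.exists_inv_empty {j : ℕ} (hj : 0 < j) : ∃ r : B n j, r.Inv = ∅ := by
  have h₀ : Cons Finset.univ (j + 1) ((∅ : Finset (Finset (Fin n))) : Set (Finset (Fin n))) :=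
    fun Y _ _ => Or.inl fun x _ y _ _ h => by simp at h
  obtain ⟨l, h₁, h₂, h₃⟩ := exists_ext h₀ (C n j)
  obtain ⟨ρ, rfl⟩ := exists_admissible ⟨h₁, h₂⟩ h₃
  exact ⟨B.mk ρ, ρ.inv_eq hj (Finset.empty_subset _) h₃⟩

/-! ### Paths as orders with consistent prefixes. -/

/-- Each prefix, added to the inversion set of the source, is the inversion set of a class visited
by the walk; hence the consistency in the last clause. -/
theorem walk_facts {j : ℕ} (hj : 0 < j) : ∀ (steps : List (Finset (Fin n) × B n j)) (r : B n j),
    IsWalk r steps → (steps.map Prod.fst).Nodup ∧ (∀ A ∈ steps.map Prod.fst, A ∉ r.Inv) ∧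
      (walkEnd r steps).Inv = r.Inv ∪ (steps.map Prod.fst).toFinset ∧
      ∀ l₁ l₂, steps.map Prod.fst = l₁ ++ l₂ → Cons Finset.univ (j + 1) {A | A ∈ r.Inv ∨ A ∈ l₁}
  | [], r, _ => by
    refine ⟨List.nodup_nil, by simp, by simp [walkEnd], fun l₁ l₂ h => ?_⟩
    obtain ⟨rfl, rfl⟩ := List.append_eq_nil_iff.1 h.symm
    simpa using r.cons_inv
  | (X, r') :: steps, r, ⟨h₁, h₂⟩ => by
    obtain ⟨i₁, i₂, i₃, i₄⟩ := walk_facts hj steps r' h₂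
    have hinv := h₁.inv_eq hj
    rw [hinv] at i₂ i₃ i₄
    refine ⟨?_, ?_, ?_, ?_⟩
    · rw [List.map_cons, List.nodup_cons]
      exact ⟨fun h => i₂ X h (Finset.mem_insert_self _ _), i₁⟩
    · intro A hA
      rcases List.mem_cons.1 hA with rfl | hA
      · exact h₁.2.1
      · exact fun h => i₂ A hA (Finset.mem_insert_of_mem h)
    · rw [walkEnd, i₃]
      ext A
      simp only [Finset.mem_union, Finset.mem_insert, List.map_cons, List.toFinset_cons]
      tauto
    · rintro (_ | ⟨Y, l₁⟩) l₂ h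
      · simpa using r.cons_inv
      · rw [List.map_cons, List.cons_append, List.cons.injEq] at h
        obtain ⟨rfl, h⟩ := h
        have := i₄ l₁ l₂ h
        refine (congrArg (Cons Finset.univ (j + 1)) (Set.ext fun A => ?_)).mp this
        simp only [Set.mem_ofPred_eq, Finset.mem_insert, List.mem_cons]
        tauto

theorem exists_walk {j : ℕ} (hj : 0 < j) : ∀ (l : List (Finset (Fin n))) (r : B n j), l.Nodup →
    (∀ A ∈ l, A ∉ r.Inv) → (∀ A ∈ l, A ∈ C n (j + 1)) →
    (∀ l₁ l₂, l = l₁ ++ l₂ → Cons Finset.univ (j + 1) {A | A ∈ r.Inv ∨ A ∈ l₁}) →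
    ∃ steps : List (Finset (Fin n) × B n j), IsWalk r steps ∧ steps.map Prod.fst = l
  | [], r, _, _, _, _ => ⟨[], trivial, rfl⟩
  | X :: l, r, hn, hd, hC, hp => by
    obtain ⟨r', hr'⟩ := B.exists_flipUp (hC X (List.mem_cons_self ..)) (hd X (List.mem_cons_self ..))
      (by
        refine (congrArg (Cons Finset.univ (j + 1)) (Set.ext fun A => ?_)).mp (hp [X] l rfl)
        simp only [Set.mem_ofPred_eq, Set.mem_insert_iff, List.mem_singleton, Finset.mem_coe]
        tauto)
    have hinv := hr'.inv_eq hj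
    rw [List.nodup_cons] at hn
    obtain ⟨steps, h₁, h₂⟩ := exists_walk hj l r' hn.2
      (by
        intro A hA h
        rw [hinv, Finset.mem_insert] at h
        rcases h with rfl | h
        · exact hn.1 hA
        · exact hd A (List.mem_cons_of_mem _ hA) h)
      (fun A hA => hC A (List.mem_cons_of_mem _ hA))
      (by
        rintro l₁ l₂ rfl
        refine (congrArg (Cons Finset.univ (j + 1)) (Set.ext fun A => ?_)).mp (hp (X :: l₁) l₂ rfl)
        simp only [Set.mem_ofPred_eq, hinv, Finset.mem_insert, List.mem_cons]
        tauto)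
    exact ⟨(X, r') :: steps, ⟨hr', h₁⟩, by rw [List.map_cons, h₂]⟩

/-- The flipped sets determine the inversion sets of the visited classes, hence the classes
themselves. -/
theorem walk_unique {j : ℕ} (hj : 0 < j) : ∀ (s s' : List (Finset (Fin n) × B n j)) (r : B n j),
    IsWalk r s → IsWalk r s' → s.map Prod.fst = s'.map Prod.fst → s = s'
  | [], [], _, _, _, _ => rfl
  | [], _ :: _, _, _, _, h => by simp at h
  | _ :: _, [], _, _, _, h => by simp at h
  | (X, r₁) :: s, (X', r₂) :: s', r, h₁, h₂, h => by
    simp only [List.map_cons, List.cons.injEq] at h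
    obtain ⟨rfl, h⟩ := h
    have : r₁ = r₂ := B.eq_of_inv_eq ((h₁.1.inv_eq hj).trans (h₂.1.inv_eq hj).symm)
    subst this
    rw [walk_unique hj s s' r₁ h₁.2 h₂.2 h]

theorem Path.eq_of_order_eq {j : ℕ} (hj : 0 < j) {J : Finset (Finset (Fin n))} {γ γ' : Path n j J}
    (h : γ.order = γ'.order) : γ = γ' := by
  obtain ⟨r, s, h₁, h₂, h₃⟩ := γ
  obtain ⟨r', s', h₁', h₂', h₃'⟩ := γ'
  have : r = r' := B.eq_of_inv_eq (h₁.trans h₁'.symm)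
  subst this
  have := walk_unique hj s s' r h₂ h₂' h
  subst this
  rfl

/-- A total order on `J` all of whose initial segments are consistent. -/
structure IsBuildOrder (k : ℕ) (J : Finset (Finset (Fin n))) (ρ : List (Finset (Fin n))) : Prop where
  nodup : ρ.Nodup
  toFinset_eq : ρ.toFinset = J
  sub : J ⊆ C n k
  cons : ∀ l₁ l₂, ρ = l₁ ++ l₂ → Cons Finset.univ k {A | A ∈ l₁}

theorem IsBuildOrder.mem_iff {k : ℕ} {J : Finset (Finset (Fin n))} {ρ : List (Finset (Fin n))}
    (h : IsBuildOrder k J ρ) {A : Finset (Fin n)} : A ∈ ρ ↔ A ∈ J := by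
  rw [← h.toFinset_eq, List.mem_toFinset]

theorem IsBuildOrder.base {k : ℕ} {J : Finset (Finset (Fin n))} {ρ : List (Finset (Fin n))}
    (h : IsBuildOrder k J ρ) : Cons Finset.univ k (J : Set (Finset (Fin n))) := by
  refine (congrArg (Cons Finset.univ k) (Set.ext fun A => ?_)).mp (h.cons ρ [] (by simp))
  exact h.mem_iff

theorem Path.isBuildOrder {j : ℕ} (hj : 0 < j) {J : Finset (Finset (Fin n))} (γ : Path n j J) :
    IsBuildOrder (j + 1) J γ.order := by
  obtain ⟨h₁, -, h₃, h₄⟩ := walk_facts hj γ.steps γ.source γ.isWalk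
  rw [γ.target_inv, γ.source_inv, Finset.empty_union] at h₃
  refine ⟨h₁, h₃.symm, ?_, fun l₁ l₂ h => ?_⟩
  · rw [← γ.target_inv]
    exact B.inv_subset _
  · simpa [γ.source_inv] using h₄ l₁ l₂ h

theorem IsBuildOrder.exists_path {j : ℕ} (hj : 0 < j) {J : Finset (Finset (Fin n))}
    {ρ : List (Finset (Fin n))} (h : IsBuildOrder (j + 1) J ρ) : ∃ γ : Path n j J, γ.order = ρ := by
  obtain ⟨r, hr⟩ := B.exists_inv_empty (n := n) hj
  obtain ⟨steps, h₁, h₂⟩ := exists_walk hj ρ r h.nodup (by simp [hr])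
    (fun A hA => h.sub (h.mem_iff.1 hA)) (fun l₁ l₂ e => by simpa [hr] using h.cons l₁ l₂ e)
  refine ⟨⟨r, steps, hr, h₁, ?_⟩, h₂⟩
  rw [(walk_facts hj steps r h₁).2.2.1, hr, h₂, Finset.empty_union, h.toFinset_eq]

/-! ### The inversion set of a path. -/

/-- The direction cannot change between prefixes: a non-antitone one contains the member erasing the
greatest element and misses the one erasing the least, a non-monotone one does the opposite, and
prefixes are nested. -/
theorem IsBuildOrder.antitone_or_monotone {k : ℕ} {J : Finset (Finset (Fin n))}
    {ρ : List (Finset (Fin n))} (h : IsBuildOrder k J ρ) {X : Finset (Fin n)}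
    (hX : X.card = k + 1) :
    (∀ l₁ l₂, ρ = l₁ ++ l₂ → AntitoneOn (fun x => X.erase x ∈ l₁) X) ∨
    (∀ l₁ l₂, ρ = l₁ ++ l₂ → MonotoneOn (fun x => X.erase x ∈ l₁) X) := by
  by_contra hcon
  simp only [not_or, not_forall] at hcon
  obtain ⟨⟨l₁, l₂, e, ha⟩, ⟨l₁', l₂', e', hm⟩⟩ := hcon
  have hmono := (h.cons l₁ l₂ e X (Finset.subset_univ _) hX).resolve_right ha
  have hanti := (h.cons l₁' l₂' e' X (Finset.subset_univ _) hX).resolve_left hm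
  obtain ⟨a, h₁⟩ := exists_isLeast (Finset.card_pos.1 (by omega : 0 < X.card))
  obtain ⟨b, h₂⟩ := exists_isGreatest (Finset.card_pos.1 (by omega : 0 < X.card))
  have hne : X.erase a ∉ l₁ := fun hh => ha fun x hx y hy _ _ => hmono h₁.1 hx (h₁.2 hx) hh
  have hne' : X.erase b ∉ l₁' := fun hh => hm fun x hx y hy _ _ => hanti hy h₂.1 (h₂.2 hy) hh
  have hb : X.erase b ∈ l₁ := by
    by_contra hb
    exact ha fun x hx y hy _ hh => absurd (hmono hy h₂.1 (h₂.2 hy) hh) hb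
  have ha' : X.erase a ∈ l₁' := by
    by_contra hb
    exact hm fun x hx y hy _ hh => absurd (hanti h₁.1 hx (h₁.2 hx) hh) hb
  rcases List.prefix_or_prefix_of_prefix (⟨l₂, e.symm⟩ : l₁ <+: ρ) (⟨l₂', e'.symm⟩ : l₁' <+: ρ) with hp | hp
  · exact hne' (hp.subset hb)
  · exact hne (hp.subset ha')

theorem IsBuildOrder.induces {k : ℕ} {J : Finset (Finset (Fin n))}
    {ρ : List (Finset (Fin n))} (h : IsBuildOrder k J ρ) {X : Finset (Fin n)}
    (hX : X.card = k + 1) :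
    (InducesAntilex ρ (packet k X) ∧ AntitoneOn (fun x => X.erase x ∈ J) X) ∨
    (InducesLex ρ (packet k X) ∧ MonotoneOn (fun x => X.erase x ∈ J) X) := by
  have split : ∀ A B, [A, B].Sublist ρ → ∃ l₁ l₂, ρ = l₁ ++ l₂ ∧ A ∈ l₁ ∧ B ∉ l₁ := by
    intro A B hs
    obtain ⟨l₁, l₂, e, h₁, h₂⟩ := (List.append_sublist_iff (l₁ := [A]) (l₂ := [B])).1 hs
    refine ⟨l₁, l₂, e, List.singleton_sublist.1 h₁, fun hB => ?_⟩
    have := h.nodup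
    rw [e, List.nodup_append] at this
    exact this.2.2 B hB B (List.singleton_sublist.1 h₂) rfl
  refine (h.antitone_or_monotone hX).imp (fun ha => ⟨?_, ?_⟩) (fun hm => ⟨?_, ?_⟩)
  · rw [InducesAntilex, List.pairwise_filter, List.pairwise_iff_forall_sublist]
    intro A B hs hA hB
    obtain ⟨l₁, l₂, e, h₁, h₂⟩ := split A B hs
    obtain ⟨x, hx, rfl⟩ := (mem_packet_iff hX).1 (of_decide_eq_true hA)
    obtain ⟨y, hy, rfl⟩ := (mem_packet_iff hX).1 (of_decide_eq_true hB)
    rw [lexLT_erase hy hx]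
    by_contra hlt
    exact h₂ (ha l₁ l₂ e hy hx (not_lt.1 hlt) h₁)
  · simpa only [h.mem_iff] using ha ρ [] (by simp)
  · rw [InducesLex, List.pairwise_filter, List.pairwise_iff_forall_sublist]
    intro A B hs hA hB
    obtain ⟨l₁, l₂, e, h₁, h₂⟩ := split A B hs
    obtain ⟨x, hx, rfl⟩ := (mem_packet_iff hX).1 (of_decide_eq_true hA)
    obtain ⟨y, hy, rfl⟩ := (mem_packet_iff hX).1 (of_decide_eq_true hB)
    rw [lexLT_erase hx hy]
    by_contra hlt
    exact h₂ (hm l₁ l₂ e hx hy (not_lt.1 hlt) h₁)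
  · simpa only [h.mem_iff] using hm ρ [] (by simp)

theorem mem_fullSet {k : ℕ} {J : Finset (Finset (Fin n))} {X : Finset (Fin n)} :
    X ∈ fullSet k J ↔ X.card = k + 1 ∧ ∀ x ∈ X, X.erase x ∈ J := by
  rw [fullSet, Finset.mem_filter, mem_C, Finset.inter_eq_left]
  refine and_congr_right fun hX => ⟨fun h x hx => h (erase_mem_packet hX hx), fun h A hA => ?_⟩
  obtain ⟨x, hx, rfl⟩ := (mem_packet_iff hX).1 hA
  exact h x hx

theorem mem_suffixSet {k : ℕ} {J : Finset (Finset (Fin n))} {X : Finset (Fin n)}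
    (hJ : Cons Finset.univ k (J : Set (Finset (Fin n)))) :
    X ∈ suffixSet k J ↔ X.card = k + 1 ∧ X ∈ sfx (J : Set (Finset (Fin n))) := by
  rw [suffixSet, Finset.mem_filter, mem_C]
  refine and_congr_right fun hX => ?_
  rw [isSuffix_iff hX, Ne, Ne, Finset.inter_eq_left]
  have hne : X.Nonempty := Finset.card_pos.1 (by omega)
  obtain ⟨a, ha⟩ := exists_isLeast hne
  obtain ⟨b, hb⟩ := exists_isGreatest hne
  simp only [sfx, Set.mem_ofPred_eq, dmin_eq ha, dmax_eq hb]
  constructor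
  · rintro ⟨hm, h₁, h₂⟩
    obtain ⟨A, hA⟩ := Finset.nonempty_iff_ne_empty.2 h₁
    rw [Finset.mem_inter] at hA
    obtain ⟨x, hx, rfl⟩ := (mem_packet_iff hX).1 hA.1
    refine ⟨hm ha.1 hx (ha.2 hx) hA.2, fun hb' => h₂ fun A hA => ?_⟩
    obtain ⟨x, hx, rfl⟩ := (mem_packet_iff hX).1 hA
    exact hm hx hb.1 (hb.2 hx) hb'
  · rintro ⟨h₁, h₂⟩
    refine ⟨(hJ X (Finset.subset_univ _) hX).resolve_left fun hm => h₂ (hm ha.1 hb.1 (ha.2 hb.1) h₁),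
      fun he => ?_, fun hs => h₂ (hs (erase_mem_packet hX hb.1))⟩
    have : X.erase a ∈ packet k X ∩ J := Finset.mem_inter.2 ⟨erase_mem_packet hX ha.1, h₁⟩
    rw [he] at this
    simp at this

/-- The inversion set of an order on `J`. -/
def orderInv (k : ℕ) (J : Finset (Finset (Fin n))) (ρ : List (Finset (Fin n))) :
    Finset (Finset (Fin n)) :=
  (fullSet k J).filter (fun X => InducesAntilex ρ (packet k X)) ∪ suffixSet k J

theorem IsBuildOrder.ext_orderInv {k : ℕ} {J : Finset (Finset (Fin n))}
    {ρ : List (Finset (Fin n))} (h : IsBuildOrder k J ρ) :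
    Ext (k + 1) (orderInv k J ρ : Set (Finset (Fin n))) ρ := by
  refine ext_of_induces fun X hX => ?_
  have hne : X.Nonempty := Finset.card_pos.1 (by omega)
  obtain ⟨a, ha⟩ := exists_isLeast hne
  obtain ⟨b, hb⟩ := exists_isGreatest hne
  rw [Finset.mem_coe, orderInv, Finset.mem_union, Finset.mem_filter, mem_fullSet,
    mem_suffixSet h.base]
  simp only [sfx, Set.mem_ofPred_eq, dmin_eq ha, dmax_eq hb, Finset.mem_coe, hX, true_and]
  rcases h.induces hX with ⟨h₁, h₂⟩ | ⟨h₁, h₂⟩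
  · refine ⟨fun _ => h₁, fun hU => ?_⟩
    rw [not_or] at hU
    -- `J` meets this packet in a final segment that is neither full nor proper, hence empty; the
    -- lexicographic condition is then vacuous.
    have hno : ∀ x ∈ X, X.erase x ∉ J := by
      intro x hx hJ
      have haJ := h₂ ha.1 hx (ha.2 hx) hJ
      have hbJ : X.erase b ∈ J := by
        by_contra hbJ
        exact hU.2 ⟨haJ, hbJ⟩
      exact hU.1 ⟨fun y hy => h₂ hy hb.1 (hb.2 hy) hbJ, h₁⟩
    rw [InducesLex, List.filter_eq_nil_iff.2]
    · exact List.Pairwise.nil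
    · intro A hA hP
      obtain ⟨x, hx, rfl⟩ := (mem_packet_iff hX).1 (of_decide_eq_true hP)
      exact hno x hx (h.mem_iff.1 hA)
  · refine ⟨?_, fun _ => h₁⟩
    rintro (hU | hU)
    · exact hU.2
    · exact absurd (h₂ ha.1 hb.1 (ha.2 hb.1) hU.1) hU.2

theorem IsBuildOrder.between {k : ℕ} {J : Finset (Finset (Fin n))}
    {ρ : List (Finset (Fin n))} (h : IsBuildOrder k J ρ) :
    Between k (J : Set (Finset (Fin n))) (orderInv k J ρ : Set (Finset (Fin n))) := by
  have hJ := h.base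
  have hsub : ∀ X : Finset (Fin n), X.card = k + 1 → X ∈ sfx (J : Set (Finset (Fin n))) →
      X ∈ (orderInv k J ρ : Set (Finset (Fin n))) := fun X hX hs =>
    Finset.mem_union_right _ ((mem_suffixSet hJ).2 ⟨hX, hs⟩)
  have htop : ∀ X : Finset (Fin n), X.card = k + 1 → X ∈ (orderInv k J ρ : Set (Finset (Fin n))) →
      dmin X ∈ (J : Set (Finset (Fin n))) := by
    intro X hX hU
    rcases Finset.mem_union.1 hU with hU | hU
    · exact dmin_mem_of_full (Finset.card_pos.1 (by omega))
        (mem_fullSet.1 (Finset.mem_filter.1 hU).1).2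
    · exact ((mem_suffixSet hJ).1 hU).2.1
  refine ⟨hJ, ?_, hsub, htop⟩
  -- To test consistency, `ρ` is continued to all `k`-sets. Outside `J` only `sfx J` matters, since
  -- a packet with a member outside `J` is not full; no step leads from outside `J` into `J`.
  obtain ⟨δ, -, h₂, h₃⟩ := exists_ext hJ.sfx (C n k \ J)
  have hδ : ∀ A, A ∈ δ ↔ A.card = k ∧ A ∉ J := fun A => by
    rw [← List.mem_toFinset, h₂, Finset.mem_sdiff, mem_C]
  have hlow := hJ.low hsub fun X hX h₁ _ hU => h₁ (htop X hX hU)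
  refine Ext.cons (ρ := ρ ++ δ) (List.pairwise_append.2 ⟨h.ext_orderInv, ?_, ?_⟩) fun A hA => ?_
  · refine h₃.imp_of_mem fun {A B} hA hB hs hs' => hs ?_
    obtain ⟨X, x, y, hX, hx, hy, rfl, rfl, g⟩ := hs'
    refine ⟨X, x, y, hX, hx, hy, rfl, rfl, ?_⟩
    have : X ∈ sfx (J : Set (Finset (Fin n))) ↔ X ∈ (orderInv k J ρ : Set (Finset (Fin n))) := by
      refine ⟨hsub X hX, fun hU => ?_⟩
      rcases Finset.mem_union.1 hU with hU | hU
      · exact absurd ((mem_fullSet.1 (Finset.mem_filter.1 hU).1).2 x hx) ((hδ _).1 hB).2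
      · exact ((mem_suffixSet hJ).1 hU).2
    rwa [this]
  · intro A hA B hB hs
    exact ((hδ B).1 hB).2 (hlow B A hs (h.mem_iff.1 hA))
  · rw [List.mem_append, h.mem_iff, hδ]
    tauto

/-- Since `J` is closed under predecessors, so is every prefix of a linear extension on `J`, and
`Low.cons` applies. -/
theorem Between.isBuildOrder {k : ℕ} {J : Finset (Finset (Fin n))} {U : Set (Finset (Fin n))}
    (h : Between k (J : Set (Finset (Fin n))) U) (hJ : J ⊆ C n k) {ρ : List (Finset (Fin n))}
    (hn : ρ.Nodup) (hρ : ρ.toFinset = J) (he : Ext (k + 1) U ρ) : IsBuildOrder k J ρ := by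
  refine ⟨hn, hρ, hJ, ?_⟩
  rintro l₁ l₂ rfl
  refine (Low.of_prefix he ?_).cons
  convert h.low using 1
  ext A
  rw [← hρ]
  simp

/-- On packets not contained in `J` both families are dictated by `J`; on full packets the order `ρ`
shows all members and reveals whether `X ∈ U`. -/
theorem Between.orderInv_eq {k : ℕ} (hk : 0 < k) {J U : Finset (Finset (Fin n))}
    (h : Between k (J : Set (Finset (Fin n))) (U : Set (Finset (Fin n)))) (hU : U ⊆ C n (k + 1))
    {ρ : List (Finset (Fin n))} (hn : ρ.Nodup) (hρ : ρ.toFinset = J)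
    (he : Ext (k + 1) (U : Set (Finset (Fin n))) ρ) : orderInv k J ρ = U := by
  have hfull : ∀ X ∈ fullSet k J, InducesAntilex ρ (packet k X) ↔ X ∈ U := fun X hX => by
    refine he.induces_antilex_iff hk hn (mem_fullSet.1 hX).1 fun A hA => ?_
    obtain ⟨x, hx, rfl⟩ := (mem_packet_iff (mem_fullSet.1 hX).1).1 hA
    rw [hρ]
    exact (mem_fullSet.1 hX).2 x hx
  ext X
  rw [orderInv, Finset.mem_union, Finset.mem_filter, mem_suffixSet h.base]
  constructor
  · rintro (⟨h₁, h₂⟩ | ⟨h₁, h₂⟩)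
    · exact (hfull X h₁).1 h₂
    · exact h.sfx_sub X h₁ h₂
  · intro hX
    have hc := mem_C.1 (hU hX)
    by_cases hd : dmax X ∈ (J : Set (Finset (Fin n)))
    · have hF : X ∈ fullSet k J := mem_fullSet.2 ⟨hc, h.base.full hc (h.sub_top X hc hX) hd⟩
      exact Or.inl ⟨hF, (hfull X hF).2 hX⟩
    · exact Or.inr ⟨hc, h.sub_top X hc hX, hd⟩

theorem orderInv_subset {k : ℕ} {J : Finset (Finset (Fin n))} {ρ : List (Finset (Fin n))} :
    orderInv k J ρ ⊆ C n (k + 1) :=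
  Finset.union_subset ((Finset.filter_subset _ _).trans (Finset.filter_subset _ _))
    (Finset.filter_subset _ _)

/-! ### Path classes and flips through inversion sets. -/

theorem PathClass.exists_rep {j : ℕ} {J : Finset (Finset (Fin n))} (r : PathClass n j J) :
    ∃ γ, PathClass.mk γ = r := Quot.exists_rep r

theorem PathClass.inv_mk {j : ℕ} {J : Finset (Finset (Fin n))} (γ : Path n j J) :
    (PathClass.mk γ).Inv = γ.Inv := rfl

theorem PathClass.mk_eq {j : ℕ} (hj : 0 < j) {J : Finset (Finset (Fin n))} {γ γ' : Path n j J}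
    (h : Ext (j + 2) (γ.Inv : Set (Finset (Fin n))) γ'.order) :
    PathClass.mk γ = PathClass.mk γ' := by
  have b := γ.isBuildOrder hj
  have b' := γ'.isBuildOrder hj
  have hp : γ.order.Perm γ'.order := List.perm_of_nodup_nodup_toFinset_eq b.nodup b'.nodup
    (b.toFinset_eq.trans b'.toFinset_eq.symm)
  have key : ∀ l, Relation.ReflTransGen (AdjSwap (Step (j + 2) (γ.Inv : Set (Finset (Fin n)))))
      γ.order l → l.Nodup ∧ l.toFinset = J ∧ Ext (j + 2) (γ.Inv : Set (Finset (Fin n))) l ∧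
        ∀ σ : Path n j J, σ.order = l → PathClass.mk γ = PathClass.mk σ := by
    intro l hl
    induction hl with
    | refl => exact ⟨b.nodup, b.toFinset_eq, b.ext_orderInv,
        fun σ hσ => by rw [Path.eq_of_order_eq hj hσ]⟩
    | tail _ hs ih =>
      obtain ⟨i₁, i₂, i₃, i₄⟩ := ih
      refine ⟨hs.perm.nodup_iff.1 i₁, by rw [← List.toFinset_eq_of_perm _ _ hs.perm, i₂],
        hs.pairwise i₃, fun σ hσ => ?_⟩
      -- The quotient relates paths only, so each intermediate list of the swap chain has to be
      -- realized by a path.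
      obtain ⟨τ, hτ⟩ := (b.between.isBuildOrder b.sub i₁ i₂ i₃).exists_path hj
      rw [i₄ τ hτ]
      exact Quot.sound (by rw [hτ, hσ]; exact hs.isElementarySwap)
  exact (key _ (reflTransGen_adjSwap _ _ b.nodup hp b.ext_orderInv h)).2.2.2 γ' rfl

theorem PathClass.eq_of_inv_eq {j : ℕ} (hj : 0 < j) {J : Finset (Finset (Fin n))}
    {r r' : PathClass n j J} (h : r.Inv = r'.Inv) : r = r' := by
  obtain ⟨γ, rfl⟩ := r.exists_rep
  obtain ⟨γ', rfl⟩ := r'.exists_rep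
  rw [PathClass.inv_mk, PathClass.inv_mk] at h
  refine PathClass.mk_eq hj ?_
  rw [h]
  exact (γ'.isBuildOrder hj).ext_orderInv

theorem PathClass.between {j : ℕ} (hj : 0 < j) {J : Finset (Finset (Fin n))}
    (r : PathClass n j J) :
    Between (j + 1) (J : Set (Finset (Fin n))) (r.Inv : Set (Finset (Fin n))) := by
  obtain ⟨γ, rfl⟩ := r.exists_rep
  exact (γ.isBuildOrder hj).between

theorem PathClass.inv_subset {j : ℕ} {J : Finset (Finset (Fin n))} (r : PathClass n j J) :
    r.Inv ⊆ C n (j + 2) := by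
  obtain ⟨γ, rfl⟩ := r.exists_rep
  exact orderInv_subset

theorem PathClass.suffixSet_subset {j : ℕ} {J : Finset (Finset (Fin n))} (r : PathClass n j J) :
    suffixSet (j + 1) J ⊆ r.Inv := by
  obtain ⟨γ, rfl⟩ := r.exists_rep
  exact Finset.subset_union_right

theorem PathClass.inv_subset_union {j : ℕ} {J : Finset (Finset (Fin n))} (r : PathClass n j J) :
    r.Inv ⊆ suffixSet (j + 1) J ∪ fullSet (j + 1) J := by
  obtain ⟨γ, rfl⟩ := r.exists_rep
  rw [Finset.union_comm]
  exact Finset.union_subset_union_left (Finset.filter_subset _ _)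

theorem Between.exists_pathClass {j : ℕ} (hj : 0 < j) {J U : Finset (Finset (Fin n))}
    (hJ : J ⊆ C n (j + 1))
    (h : Between (j + 1) (J : Set (Finset (Fin n))) (U : Set (Finset (Fin n))))
    (hU : U ⊆ C n (j + 2)) : ∃ r : PathClass n j J, r.Inv = U := by
  obtain ⟨ρ, h₁, h₂, h₃⟩ := exists_ext h.cons J
  obtain ⟨γ, rfl⟩ := (h.isBuildOrder hJ h₁ h₂ h₃).exists_path hj
  exact ⟨PathClass.mk γ, h.orderInv_eq (Nat.succ_pos j) hU h₁ h₂ h₃⟩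

theorem packet_subset_of_fullSet {k : ℕ} {J : Finset (Finset (Fin n))} {X : Finset (Fin n)}
    (hX : X ∈ fullSet k J) : packet k X ⊆ J := by
  intro A hA
  rw [mem_fullSet] at hX
  obtain ⟨x, hx, rfl⟩ := (mem_packet_iff hX.1).1 hA
  exact hX.2 x hx

theorem PathClass.FlipUp.inv_eq {j : ℕ} (hj : 0 < j) {J : Finset (Finset (Fin n))}
    {X : Finset (Fin n)} {r r' : PathClass n j J} (h : PathClass.FlipUp X r r') :
    r'.Inv = insert X r.Inv := by
  obtain ⟨hX, hXr, γ, γ', rfl, rfl, l₁, c, l₂, hc, e, e'⟩ := h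
  rw [PathClass.inv_mk, PathClass.inv_mk]
  rw [PathClass.inv_mk] at hXr
  have b := γ.isBuildOrder hj
  have b' := γ'.isBuildOrder hj
  have hcard := (mem_fullSet.1 hX).1
  have he : Ext (j + 2) ((insert X γ.Inv : Finset (Finset (Fin n))) : Set (Finset (Fin n))) γ'.order := by
    rw [e']
    refine Ext.reverse_packet (U := (γ.Inv : Set (Finset (Fin n)))) hcard (fun Y hY => ?_) ?_
      (e ▸ b.nodup) hc (e ▸ b.ext_orderInv)
    · rw [Finset.mem_coe, Finset.mem_insert]
      exact or_iff_right hY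
    · simpa using hXr
  have hfull : ∀ Y ∈ fullSet (j + 1) J, InducesAntilex γ'.order (packet (j + 1) Y) ↔
      Y ∈ insert X γ.Inv := fun Y hY =>
    he.induces_antilex_iff (Nat.succ_pos j) b'.nodup (mem_fullSet.1 hY).1
      ((packet_subset_of_fullSet hY).trans b'.toFinset_eq.ge)
  ext Y
  constructor
  · intro hY
    rcases Finset.mem_union.1 hY with hY | hY
    · obtain ⟨h₁, h₂⟩ := Finset.mem_filter.1 hY
      exact (hfull Y h₁).1 h₂
    · exact Finset.mem_insert_of_mem (Finset.mem_union_right _ hY)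
  · intro hY
    rcases Finset.mem_insert.1 hY with rfl | hY'
    · exact Finset.mem_union_left _ (Finset.mem_filter.2 ⟨hX, (hfull Y hX).2 hY⟩)
    · rcases Finset.mem_union.1 hY' with hY' | hY'
      · have h₁ := (Finset.mem_filter.1 hY').1
        exact Finset.mem_union_left _ (Finset.mem_filter.2 ⟨h₁, (hfull Y h₁).2 hY⟩)
      · exact Finset.mem_union_right _ hY'

/-- Adding one full packet to the inversion set, keeping consistency, is a packet flip. -/
theorem PathClass.flipUp_of_inv_eq {j : ℕ} (hj : 0 < j) {J : Finset (Finset (Fin n))}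
    {X : Finset (Fin n)} {r r' : PathClass n j J} (hX : X ∈ fullSet (j + 1) J) (hXr : X ∉ r.Inv)
    (h : r'.Inv = insert X r.Inv) : PathClass.FlipUp X r r' := by
  have br := r.between hj
  have br' := r'.between hj
  obtain ⟨γ, rfl⟩ := r.exists_rep
  rw [PathClass.inv_mk] at br h hXr
  have b := γ.isBuildOrder hj
  have hcard := (mem_fullSet.1 hX).1
  have hsub : packet (j + 1) X ⊆ γ.order.toFinset := by
    rw [b.toFinset_eq]
    exact packet_subset_of_fullSet hX
  obtain ⟨l₁, c, l₂, hp, hc, h₁, h₂⟩ := Ext.exists_block hcard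
    (U' := (r'.Inv : Set (Finset (Fin n))))
    (fun Y hY => by rw [h, Finset.mem_coe, Finset.mem_insert]; exact or_iff_right hY)
    (by rw [h]; simpa using hXr) br.cons br'.cons b.nodup b.ext_orderInv hsub
  have hp' : γ.order.Perm (l₁ ++ c.reverse ++ l₂) := hp.trans
    (((List.reverse_perm c).symm.append_left l₁).append_right l₂)
  have t : (l₁ ++ c ++ l₂).toFinset = J := by
    rw [← List.toFinset_eq_of_perm _ _ hp, b.toFinset_eq]
  have t' : (l₁ ++ c.reverse ++ l₂).toFinset = J := by
    rw [← List.toFinset_eq_of_perm _ _ hp', b.toFinset_eq]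
  obtain ⟨σ, hσ⟩ := (br.isBuildOrder b.sub (hp.nodup_iff.1 b.nodup) t h₁).exists_path hj
  obtain ⟨τ, hτ⟩ := (br'.isBuildOrder b.sub (hp'.nodup_iff.1 b.nodup) t' h₂).exists_path hj
  refine ⟨hX, hXr, σ, τ, (PathClass.mk_eq hj (hσ ▸ h₁)).symm, ?_, l₁, c, l₂, hc, hσ, hτ⟩
  refine PathClass.eq_of_inv_eq hj ?_
  exact br'.orderInv_eq (Nat.succ_pos j) r'.inv_subset (hτ ▸ hp'.nodup_iff.1 b.nodup)
    (hτ ▸ t') (hτ ▸ h₂)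

theorem mem_fullSet_of_mem_top {k : ℕ} {J : Finset (Finset (Fin n))} {X : Finset (Fin n)}
    (hJ : Cons Finset.univ k (J : Set (Finset (Fin n)))) (hX : X.card = k + 1)
    (h₁ : X ∈ top (J : Set (Finset (Fin n)))) (h₂ : X ∉ sfx (J : Set (Finset (Fin n)))) :
    X ∈ fullSet k J :=
  mem_fullSet.2 ⟨hX, hJ.full hX h₁ (by by_contra h; exact h₂ ⟨h₁, h⟩)⟩

theorem mem_suffixSet_union_fullSet {k : ℕ} {J : Finset (Finset (Fin n))} {X : Finset (Fin n)}
    (hJ : Cons Finset.univ k (J : Set (Finset (Fin n)))) :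
    X ∈ suffixSet k J ∪ fullSet k J ↔ X.card = k + 1 ∧ X ∈ top (J : Set (Finset (Fin n))) := by
  rw [Finset.mem_union, mem_suffixSet hJ]
  constructor
  · rintro (h | h)
    · exact ⟨h.1, h.2.1⟩
    · rw [mem_fullSet] at h
      exact ⟨h.1, dmin_mem_of_full (Finset.card_pos.1 (by omega)) h.2⟩
  · rintro ⟨hX, h⟩
    by_cases hs : X ∈ sfx (J : Set (Finset (Fin n)))
    · exact Or.inl ⟨hX, hs⟩
    · exact Or.inr (mem_fullSet_of_mem_top hJ hX h hs)

/-- `Between.exists_erase` supplies a smaller admissible inversion set; its class lies one flip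
below. -/
theorem PathClass.exists_flip_down {j : ℕ} (hj : 0 < j) {J : Finset (Finset (Fin n))}
    (r : PathClass n j J) (h : r.Inv ≠ suffixSet (j + 1) J) :
    ∃ r' X, PathClass.FlipUp X r' r := by
  have br := r.between hj
  have hJ : J ⊆ C n (j + 1) := by
    obtain ⟨γ, rfl⟩ := r.exists_rep
    exact (γ.isBuildOrder hj).sub
  obtain ⟨X₀, h₀, h₀'⟩ : ∃ X ∈ r.Inv, X ∉ suffixSet (j + 1) J := by
    by_contra hcon
    push Not at hcon
    exact h (Finset.Subset.antisymm hcon r.suffixSet_subset)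
  have hc₀ := mem_C.1 (r.inv_subset h₀)
  obtain ⟨X, hX, hXs, hc, hcons⟩ := br.exists_erase hc₀ h₀
    (fun hs => h₀' ((mem_suffixSet br.base).2 ⟨hc₀, hs⟩))
  have hF := mem_fullSet_of_mem_top br.base hc (br.sub_top X hc hX) hXs
  have bU : Between (j + 1) (J : Set (Finset (Fin n)))
      ((r.Inv.erase X : Finset (Finset (Fin n))) : Set (Finset (Fin n))) := by
    refine ⟨br.base, by rwa [Finset.coe_erase], fun Y hY hs => ?_,
      fun Y hY hU => br.sub_top Y hY (Finset.mem_of_mem_erase hU)⟩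
    refine Finset.mem_coe.2 (Finset.mem_erase.2 ⟨?_, br.sfx_sub Y hY hs⟩)
    rintro rfl
    exact hXs hs
  obtain ⟨r', hr'⟩ := bU.exists_pathClass hj hJ ((Finset.erase_subset _ _).trans r.inv_subset)
  refine ⟨r', X, PathClass.flipUp_of_inv_eq hj hF ?_ ?_⟩
  · rw [hr']
    exact Finset.notMem_erase _ _
  · rw [hr', Finset.insert_erase hX]

theorem PathClass.exists_flip_up {j : ℕ} (hj : 0 < j) {J : Finset (Finset (Fin n))}
    (r : PathClass n j J) (h : r.Inv ≠ suffixSet (j + 1) J ∪ fullSet (j + 1) J) :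
    ∃ r' X, PathClass.FlipUp X r r' := by
  have br := r.between hj
  have hJ : J ⊆ C n (j + 1) := by
    obtain ⟨γ, rfl⟩ := r.exists_rep
    exact (γ.isBuildOrder hj).sub
  obtain ⟨X₀, h₀, h₀'⟩ : ∃ X ∈ suffixSet (j + 1) J ∪ fullSet (j + 1) J, X ∉ r.Inv := by
    by_contra hcon
    push Not at hcon
    exact h (Finset.Subset.antisymm r.inv_subset_union hcon)
  obtain ⟨hc₀, ht₀⟩ := (mem_suffixSet_union_fullSet br.base).1 h₀
  obtain ⟨X, hX, hXU, hc, hcons⟩ := br.exists_insert hc₀ ht₀ h₀'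
  have hF := mem_fullSet_of_mem_top br.base hc hX fun hs => hXU (br.sfx_sub X hc hs)
  have bU : Between (j + 1) (J : Set (Finset (Fin n)))
      ((insert X r.Inv : Finset (Finset (Fin n))) : Set (Finset (Fin n))) := by
    refine ⟨br.base, by rwa [Finset.coe_insert], fun Y hY hs =>
      Finset.mem_insert_of_mem (br.sfx_sub Y hY hs), fun Y hY hU => ?_⟩
    rcases Finset.mem_insert.1 hU with rfl | hU
    · exact hX
    · exact br.sub_top Y hY hU
  obtain ⟨r', hr'⟩ := bU.exists_pathClass hj hJ
    (Finset.insert_subset (mem_C.2 hc) r.inv_subset)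
  exact ⟨r', X, PathClass.flipUp_of_inv_eq hj hF hXU hr'⟩

/-! ### Extremal elements. -/

theorem PathClass.inv_mono {j : ℕ} (hj : 0 < j) {J : Finset (Finset (Fin n))}
    {r r' : PathClass n j J} (h : r ≤ r') : r.Inv ⊆ r'.Inv := by
  induction h with
  | refl => exact Finset.Subset.refl _
  | tail _ hs ih =>
    obtain ⟨X, hX⟩ := hs
    rw [hX.inv_eq hj]
    exact ih.trans (Finset.subset_insert _ _)

theorem PathClass.FlipUp.le {j : ℕ} {J : Finset (Finset (Fin n))} {X : Finset (Fin n)}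
    {r r' : PathClass n j J} (h : PathClass.FlipUp X r r') : r ≤ r' :=
  Relation.ReflTransGen.single ⟨X, h⟩

theorem PathClass.FlipUp.not_ge {j : ℕ} (hj : 0 < j) {J : Finset (Finset (Fin n))}
    {X : Finset (Fin n)} {r r' : PathClass n j J} (h : PathClass.FlipUp X r r') : ¬ r' ≤ r := by
  intro hle
  have := PathClass.inv_mono hj hle
  rw [h.inv_eq hj] at this
  exact h.2.1 (this (Finset.mem_insert_self _ _))

theorem PathClass.isMin_iff {j : ℕ} (hj : 0 < j) {J : Finset (Finset (Fin n))}
    (r : PathClass n j J) : IsMin r ↔ r.Inv = suffixSet (j + 1) J := by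
  constructor
  · intro hr
    by_contra h
    obtain ⟨r', X, hX⟩ := r.exists_flip_down hj h
    exact hX.not_ge hj (hr hX.le)
  · intro h r' hr'
    have := PathClass.inv_mono hj hr'
    rw [h] at this
    rw [PathClass.eq_of_inv_eq hj (h.trans (Finset.Subset.antisymm r'.suffixSet_subset this))]

theorem PathClass.isMax_iff {j : ℕ} (hj : 0 < j) {J : Finset (Finset (Fin n))}
    (r : PathClass n j J) : IsMax r ↔ r.Inv = suffixSet (j + 1) J ∪ fullSet (j + 1) J := by
  constructor
  · intro hr
    by_contra h
    obtain ⟨r', X, hX⟩ := r.exists_flip_up hj h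
    exact hX.not_ge hj (hr hX.le)
  · intro h r' hr'
    have := PathClass.inv_mono hj hr'
    rw [h] at this
    rw [PathClass.eq_of_inv_eq hj (h.trans (Finset.Subset.antisymm this r'.inv_subset_union))]

/-- `sfx J` and `top J` impose no size restriction, unlike `suffixSet` and `fullSet`; only sets of
the relevant size matter for consistency. -/
theorem cons_congr {m : ℕ} {U V : Set (Finset (Fin n))} (h : ∀ X, X.card = m → (X ∈ U ↔ X ∈ V))
    (hU : Cons Finset.univ m U) : Cons Finset.univ m V := by
  intro Y hY hc
  have key : ∀ x ∈ Y, (Y.erase x ∈ U ↔ Y.erase x ∈ V) := fun x hx =>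
    h _ (by rw [Finset.card_erase_of_mem hx, hc]; rfl)
  refine (hU Y hY hc).imp (fun hm x hx y hy hxy => ?_) (fun hm x hx y hy hxy => ?_)
  · exact fun h => (key y hy).1 (hm hx hy hxy ((key x hx).2 h))
  · exact fun h => (key x hx).1 (hm hx hy hxy ((key y hy).2 h))

theorem between_suffixSet {k : ℕ} {J : Finset (Finset (Fin n))}
    (hJ : Cons Finset.univ k (J : Set (Finset (Fin n)))) :
    Between k (J : Set (Finset (Fin n))) (suffixSet k J : Set (Finset (Fin n))) := by
  refine ⟨hJ, cons_congr (fun X hX => ?_) hJ.sfx, fun X hX hs => (mem_suffixSet hJ).2 ⟨hX, hs⟩,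
    fun X _ hU => ((mem_suffixSet hJ).1 hU).2.1⟩
  rw [Finset.mem_coe, mem_suffixSet hJ]
  simp [hX]

theorem between_suffixSet_union_fullSet {k : ℕ} {J : Finset (Finset (Fin n))}
    (hJ : Cons Finset.univ k (J : Set (Finset (Fin n)))) :
    Between k (J : Set (Finset (Fin n)))
      ((suffixSet k J ∪ fullSet k J : Finset (Finset (Fin n))) : Set (Finset (Fin n))) := by
  refine ⟨hJ, cons_congr (fun X hX => ?_) hJ.top,
    fun X hX hs => (mem_suffixSet_union_fullSet hJ).2 ⟨hX, hs.1⟩,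
    fun X _ hU => ((mem_suffixSet_union_fullSet hJ).1 hU).2⟩
  rw [Finset.mem_coe, mem_suffixSet_union_fullSet hJ]
  simp [hX]

end HigherBruhat

theorem mainTheorem2 (n k : ℕ) (hk : 1 < k) (hkn : k ≤ n)
    (J : Finset (Finset (Fin n))) (hJ : HigherBruhat.Realizable k J) :
    (∀ r r' : HigherBruhat.SecondBruhatOrder n k J, r ≤ r' → r' ≤ r → r = r') ∧
    ∃ rmin rmax : HigherBruhat.SecondBruhatOrder n k J,
      (∀ r : HigherBruhat.SecondBruhatOrder n k J, IsMin r ↔ r = rmin) ∧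
      (∀ r : HigherBruhat.SecondBruhatOrder n k J, IsMax r ↔ r = rmax) ∧
      (∀ r : HigherBruhat.SecondBruhatOrder n k J,
        r.Inv = HigherBruhat.suffixSet k J ↔ r = rmin) ∧
      (∀ r : HigherBruhat.SecondBruhatOrder n k J,
        r.Inv = HigherBruhat.suffixSet k J ∪ HigherBruhat.fullSet k J ↔ r = rmax) := by
  obtain ⟨j, rfl⟩ : ∃ j, k = j + 1 := ⟨k - 1, by omega⟩
  -- This is where `1 < k` enters: packets in `B(n,j)` then have at least two members, so inversion
  -- sets determine orientations.
  have hj : 0 < j := by omega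
  obtain ⟨hJC, hJc⟩ := HigherBruhat.realizable_iff.1 hJ
  have b₁ := HigherBruhat.between_suffixSet hJc
  have b₂ := HigherBruhat.between_suffixSet_union_fullSet hJc
  obtain ⟨rmin, hmin⟩ := b₁.exists_pathClass hj hJC (Finset.filter_subset _ _)
  obtain ⟨rmax, hmax⟩ := b₂.exists_pathClass hj hJC
    (Finset.union_subset (Finset.filter_subset _ _) (Finset.filter_subset _ _))
  have e₁ : ∀ r : HigherBruhat.PathClass n j J,
      r.Inv = HigherBruhat.suffixSet (j + 1) J ↔ r = rmin := fun r =>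
    ⟨fun h => HigherBruhat.PathClass.eq_of_inv_eq hj (h.trans hmin.symm), fun h => h ▸ hmin⟩
  have e₂ : ∀ r : HigherBruhat.PathClass n j J,
      r.Inv = HigherBruhat.suffixSet (j + 1) J ∪ HigherBruhat.fullSet (j + 1) J ↔ r = rmax :=
    fun r => ⟨fun h => HigherBruhat.PathClass.eq_of_inv_eq hj (h.trans hmax.symm), fun h => h ▸ hmax⟩
  refine ⟨fun r r' h h' => HigherBruhat.PathClass.eq_of_inv_eq hj
    (Finset.Subset.antisymm (HigherBruhat.PathClass.inv_mono hj h)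
      (HigherBruhat.PathClass.inv_mono hj h')), rmin, rmax, fun r => ?_, fun r => ?_, e₁, e₂⟩
  · exact (HigherBruhat.PathClass.isMin_iff hj r).trans (e₁ r)
  · exact (HigherBruhat.PathClass.isMax_iff hj r).trans (e₂ r)
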